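/- Let $T>0$, $\delta\in[0,1]$, $\lambda\in L^\infty([0,T])$ with $\lambda\ge 0$ a.e., $\kappa\in C^1([0,T])$ with $\kappa\ge 0$, $\eta\in C^1([0,T])$ with $\eta>0$, and assume $\lambda+\delta\dot\kappa\ge 0$ a.e. on $[0,T]$. Let $\nu_0$ be a probability measure on $\mathbb R$ with finite first absolute moment, and put $\mathbb E[\nu_0]=\int x\,\nu_0(dx)$, $q_0(x)=\nu_0([x,\infty))$, $p_0(x)=\nu_0((-\infty,x])$. Let $A$ be the (absolutely continuous) solution on $[0,T)$ of $$-\dot A_t=-\frac{A_t^2}{\eta_t}+\delta\frac{\kappa_t}{\eta_t}A_t+\lambda_t,\qquad \lim_{t\nearrow T}A_t=\infty,$$ and put $$h_t=e^{-\int_0^t\frac{A_r}{\eta_r}dr}\int_0^t\frac1{\eta_s}e^{\int_0^s\frac{2A_r-\delta\kappa_r}{\eta_r}dr}ds,\qquad \alpha_T^\delta=\Big(\lim_{t\nearrow T}h_t\Big)^{-1}.$$ For $\mu\in L^1([0,T])$ (a real-valued integrable function on $[0,T]$) and $x\in\mathbb R$ let $$f_\mu(t)=\int_0^t\kappa_u\mu_u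 h_u\,du,\qquad \tau_\mu(x)=\inf\{t\in[0,T]: f_\mu(t)=x\}\quad(\inf\emptyset=T),$$ let $(X^{x,\mu},Y^{x,\mu})$ be the continuous solution on $[0,T]$ of $$\dot X_t=-\frac{Y_t-\delta\kappa_tX_t}{\eta_t}1_{\{t\le\tau_\mu(x)\}},\qquad -\dot Y_t=(\lambda_tX_t+\kappa_t\mu_t)1_{\{t\le\tau_\mu(x)\}}\quad\text{for a.e. }t,\qquad X_0=x,\ X_T=0,$$ where $Y_{\tau_\mu(x)}=0$ is also required if $\tau_\mu(x)<T$ (this matters only for $x=0$, where it selects $Y\equiv 0$), and let $$\xi^{x,\mu}=\frac{Y^{x,\mu}-\delta\kappa X^{x,\mu}}{\eta},\qquad F(\mu)_t=\int_{\mathbb R}\xi^{x,\mu}_t\,\nu_0(dx).$$ We call $\mu$ a fixed point (for $\nu_0$) if $\mu_t=F(\mu)_t$ for all $t\in[0,T]$. (i) If $\mu\in L^1([0,T])$ is a fixed point, then $\operatorname{sign}(\mu_t)=\operatorname{sign}(\mathbb E[\nu_0])$ for all $t\in[0,T]$. (ii) Suppose $\mathbb E[\nu_0]>0$ and $\nu_0(\{0\})=0$.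 Then $\mu\in L^1([0,T])$ is a fixed point if and only if, for all $t\in[0,T]$, $$\mu_t=\mu_T+\int_t^T\frac{\kappa_s}{\eta_s}\big(q_0(f_\mu(s))+p_0(0)\big)\mu_s\,ds+\int_t^T\frac{\lambda_s+\delta\dot\kappa_s}{\eta_s}\Big(\int_s^T\mu_u\,du\Big)ds+\int_t^T\frac{\dot\eta_s-\delta\kappa_s}{\eta_s}\mu_s\,ds$$ and, with $x_\mu:=f_\mu(T)$, $$\mu_T=\frac{\alpha_T^\delta}{\eta_T}\Big(\mathbb E[\nu_0]-(1-q_0(0))x_\mu-\int_0^{x_\mu}q_0(x)\,dx\Big).$$ (iii) If $\mathbb E[\nu_0]<0$, let $\tilde\nu_0$ be the image of $\nu_0$ under $x\mapsto -x$. Then $\mathbb E[\tilde\nu_0]>0$, and $\mu\in L^1([0,T])$ is a fixed point for $\nu_0$ if and only if $-\mu$ is a fixed point for $\tilde\nu_0$. -/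

import Mathlib

open MeasureTheory Set Filter Topology

noncomputable section

namespace Liquidation

/-- Time horizon `T`, the parameter `δ` (`0` for the mean-field game, `1/N` for the
`N`-player game) and the cost coefficients `η`, `κ`, `lam` (the risk coefficient `λ`). -/
structure Params where
  T : ℝ
  δ : ℝ
  η : ℝ → ℝ
  κ : ℝ → ℝ
  lam : ℝ → ℝ

namespace Params

variable (P : Params)

/-- The derivative of `η` on `[0,T]` (one-sided at the end points). -/
def dη (t : ℝ) : ℝ := derivWithin P.η (Icc 0 P.T) t

/-- The derivative of `κ` on `[0,T]` (one-sided at the end points). -/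
def dκ (t : ℝ) : ℝ := derivWithin P.κ (Icc 0 P.T) t

/-- The standing assumptions: `λ ∈ L^∞_+`, `κ ∈ C^1_+`, `η ∈ C^1([0,T]; (0,∞))`,
`δ ∈ [0,1]` and `λ + δ κ' ≥ 0`. -/
structure Admissible : Prop where
  T_pos : 0 < P.T
  δ_mem : P.δ ∈ Icc (0 : ℝ) 1
  η_contDiff : ContDiffOn ℝ 1 P.η (Icc 0 P.T)
  η_pos : ∀ t ∈ Icc 0 P.T, 0 < P.η t
  κ_contDiff : ContDiffOn ℝ 1 P.κ (Icc 0 P.T)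
  κ_nonneg : ∀ t ∈ Icc 0 P.T, 0 ≤ P.κ t
  lam_memLp : MemLp P.lam ⊤ (volume.restrict (Icc 0 P.T))
  lam_nonneg : ∀ᵐ t ∂(volume.restrict (Icc 0 P.T)), 0 ≤ P.lam t
  lam_add_nonneg : ∀ᵐ t ∂(volume.restrict (Icc 0 P.T)), 0 ≤ P.lam t + P.δ * P.dκ t

/-- `A` solves the singular terminal value problem
`-A' = -A² / η + δ (κ / η) A + λ` on `[0,T)`, `A_t → ∞` as `t ↑ T`
(an absolutely continuous solution, the equation being written in integrated form). -/
structure IsRiccatiSolution (A : ℝ → ℝ) : Prop where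
  continuousOn : ContinuousOn A (Ico 0 P.T)
  eq : ∀ s t, 0 ≤ s → s ≤ t → t < P.T →
    A t = A s + ∫ r in s..t, (A r ^ 2 / P.η r - P.δ * (P.κ r / P.η r) * A r - P.lam r)
  tendsto : Tendsto A (𝓝[<] P.T) atTop

/-- The process `A^δ`: the solution of the singular terminal value problem. -/
def A : ℝ → ℝ := Classical.epsilon fun A => P.IsRiccatiSolution A

/-- `h^δ_t = exp(-∫₀ᵗ A/η) ∫₀ᵗ (1/η_s) exp(∫₀ˢ (2A - δκ)/η) ds`. -/
def h (t : ℝ) : ℝ :=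
  Real.exp (-∫ r in (0 : ℝ)..t, P.A r / P.η r) *
    ∫ s in (0 : ℝ)..t,
      1 / P.η s * Real.exp (∫ r in (0 : ℝ)..s, (2 * P.A r - P.δ * P.κ r) / P.η r)

/-- `α^δ_T = (lim_{t ↑ T} h^δ_t)⁻¹`. -/
def α : ℝ := (limUnder (𝓝[<] P.T) P.h)⁻¹

/-- `f_μ(t) = ∫₀ᵗ κ_u μ_u h^δ_u du`. -/
def f (μ : ℝ → ℝ) (t : ℝ) : ℝ := ∫ u in (0 : ℝ)..t, P.κ u * μ u * P.h u

open Classical in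
/-- The candidate liquidation time: the first time at which `f_μ` reaches the level `x`, with
the convention `inf ∅ = T` if this never happens on `[0,T]`. -/
def τ (μ : ℝ → ℝ) (x : ℝ) : ℝ :=
  if ∃ t ∈ Icc 0 P.T, P.f μ t = x then sInf {t | t ∈ Icc 0 P.T ∧ P.f μ t = x} else P.T

/-- `(X, Y)` is a continuous solution of the forward-backward system
`X' = -((Y - δ κ X) / η) 1_{t ≤ τ}`, `-Y' = (λ X + κ μ) 1_{t ≤ τ}`, `X_0 = x`, `X_T = 0`
with `τ = τ_μ(x)`, written in integrated form. The last field is the requirement `Y_τ = 0` in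
the case `τ < T` (recall that `Y` is constant after `τ`). It follows from the
others if `0 < τ < T`, and it selects the solution `Y = 0` if `τ = 0`. -/
structure IsFBSolution (μ : ℝ → ℝ) (x : ℝ) (X Y : ℝ → ℝ) : Prop where
  continuousOn_X : ContinuousOn X (Icc 0 P.T)
  continuousOn_Y : ContinuousOn Y (Icc 0 P.T)
  eq_X : ∀ t ∈ Icc 0 P.T, X t = x -
    ∫ s in (0 : ℝ)..t, (Iic (P.τ μ x)).indicator
      (fun s => (Y s - P.δ * P.κ s * X s) / P.η s) s
  eq_Y : ∀ t ∈ Icc 0 P.T, Y t = Y P.T +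
    ∫ s in t..P.T, (Iic (P.τ μ x)).indicator
      (fun s => P.lam s * X s + P.κ s * μ s) s
  X_T : X P.T = 0
  Y_T : P.τ μ x < P.T → Y P.T = 0

/-- The solution `(X^{δ,x,μ}, Y^{δ,x,μ})` of the forward-backward system. -/
def XY (μ : ℝ → ℝ) (x : ℝ) : (ℝ → ℝ) × (ℝ → ℝ) :=
  Classical.epsilon fun p => P.IsFBSolution μ x p.1 p.2

/-- The candidate strategy `ξ^{δ,x,μ} = (Y^{δ,x,μ} - δ κ X^{δ,x,μ}) / η`. -/
def ξ (μ : ℝ → ℝ) (x t : ℝ) : ℝ :=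
  ((P.XY μ x).2 t - P.δ * P.κ t * (P.XY μ x).1 t) / P.η t

/-- The fixed-point map `F(μ)_t = ∫ ξ^{δ,x,μ}_t ν₀(dx)`. -/
def F (ν₀ : Measure ℝ) (μ : ℝ → ℝ) (t : ℝ) : ℝ := ∫ x, P.ξ μ x t ∂ν₀

/-- `μ_t = F(μ)_t` for all `t ∈ [0,T]`. -/
def IsFixedPoint (ν₀ : Measure ℝ) (μ : ℝ → ℝ) : Prop :=
  ∀ t ∈ Icc 0 P.T, μ t = P.F ν₀ μ t

end Params

/-- Left tail distribution function `p₀(x) = ν₀((-∞, x])`. -/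
def p₀ (ν₀ : Measure ℝ) (x : ℝ) : ℝ := ν₀.real (Iic x)

/-- Right tail distribution function `q₀(x) = ν₀([x, ∞))`. -/
def q₀ (ν₀ : Measure ℝ) (x : ℝ) : ℝ := ν₀.real (Ici x)

/-- The mean initial position `E[ν₀]`. -/
def mean (ν₀ : Measure ℝ) : ℝ := ∫ x, x ∂ν₀

namespace Params

variable (P : Params)

/-- The simplified integral equation on `[0,T]`. -/
def SolvesSimplified (ν₀ : Measure ℝ) (μ : ℝ → ℝ) : Prop :=
  ∀ t ∈ Icc 0 P.T,
    μ t = μ P.T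
      + (∫ s in t..P.T, P.κ s / P.η s * (q₀ ν₀ (P.f μ s) + p₀ ν₀ 0) * μ s)
      + (∫ s in t..P.T, (P.lam s + P.δ * P.dκ s) / P.η s * ∫ u in s..P.T, μ u)
      + ∫ s in t..P.T, (P.dη s - P.δ * P.κ s) / P.η s * μ s

/-- The endogenous terminal condition, with `x_μ = f_μ(T)`. -/
def TerminalCondition (ν₀ : Measure ℝ) (μ : ℝ → ℝ) : Prop :=
  μ P.T = P.α / P.η P.T *
    (mean ν₀ - (1 - q₀ ν₀ 0) * P.f μ P.T - ∫ x in (0 : ℝ)..(P.f μ P.T), q₀ ν₀ x)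

end Params

end Liquidation

end

/-! Dividing `X` by the integrating factor `G = exp ∫ δκ/η` turns the forward-backward equations
before liquidation into a planar linear system driven by `κ μ`. The homogeneous system has a
fundamental pair: `(h, p)` starting from `(0, 1)`, and `(u, w)` ending in `(0, 1)` at `T`
(`IsFundamental`). The Riccati solution is `A = w / (u G)` up to the choice made by `epsilon`, and
the `h` of the statement is this linear solution (`h_eq`), so `α = 1 / h(T)`. Variation of constants
then gives `X`, `Y` explicitly in terms of `x - f_μ` and a second primitive of `κ μ`; `f_μ(τ) = x`
is exactly what makes both vanish at an early exit.

These formulas are linear in `x` and in the stopped primitives, so they can be averaged over `ν₀` by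
Fubini. The outcome (`exists_aggregate`) is a linear equation for `F(μ)` with the mean state `X`,
where `X' = -F(μ)`, `X_0 = E[ν₀]`, `X_T = 0`, and the source is weighted by the surviving mass.

Everything else rests on one sign principle, `sign_eq_of_damped`: if `m' = -z`, `z' = -(a m + b z)`,
`a ≥ 0` and `m_T = 0`, then `z` has constant sign, that of `m_0`. With `z = F(μ) = μ` it gives (i).
In (ii), `μ > 0` makes `f_μ` monotone, so the surviving mass becomes `q₀(f_μ) + p₀(0)` wherever `κ ≠
0`, and the aggregate equation becomes the simplified one. For the converse, the principle with `z =
μ` and the terminal condition force `μ > 0`; applied again to `z = μ - F(μ)`, which vanishes at `T`,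
it gives `μ = F(μ)`. Part (iii) is oddness under `(x, μ) ↦ (-x, -μ)`. -/

noncomputable section

/-! ### Calculus of absolutely continuous functions -/

/-- `F` is absolutely continuous between `a` and `b`, with almost everywhere derivative `F'`. -/
def HasACDeriv (F F' : ℝ → ℝ) (a b : ℝ) : Prop :=
  AbsolutelyContinuousOnInterval F a b ∧ ∀ᵐ x, x ∈ uIcc a b → HasDerivAt F (F' x) x

theorem ae_mem_uIcc_imp_mem_uIoo (a b : ℝ) : ∀ᵐ x : ℝ, x ∈ uIcc a b → x ∈ uIoo a b := by
  have h₁ : ∀ᵐ x : ℝ, x ≠ a := by simp [ae_iff, measure_singleton]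
  have h₂ : ∀ᵐ x : ℝ, x ≠ b := by simp [ae_iff, measure_singleton]
  filter_upwards [h₁, h₂] with x ha hb hx
  grind [uIcc, uIoo]

theorem AbsolutelyContinuousOnInterval.congr {F G : ℝ → ℝ} {a b : ℝ}
    (hF : AbsolutelyContinuousOnInterval F a b) (h : EqOn F G (uIcc a b)) :
    AbsolutelyContinuousOnInterval G a b := by
  rw [absolutelyContinuousOnInterval_iff] at hF ⊢
  intro ε hε
  obtain ⟨δ, hδ, H⟩ := hF ε hε
  refine ⟨δ, hδ, fun E hE hlt => ?_⟩
  refine lt_of_eq_of_lt (Finset.sum_congr rfl fun i hi => ?_) (H E hE hlt)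
  have := hE.1 i hi
  rw [h this.1, h this.2]

theorem AbsolutelyContinuousOnInterval.lipschitz_comp {F φ : ℝ → ℝ} {a b : ℝ} {K : NNReal}
    (hF : AbsolutelyContinuousOnInterval F a b) (h : LipschitzOnWith K φ (F '' uIcc a b)) :
    AbsolutelyContinuousOnInterval (fun x => φ (F x)) a b := by
  rw [absolutelyContinuousOnInterval_iff] at hF ⊢
  intro ε hε
  obtain ⟨δ, hδ, H⟩ := hF (ε / (K + 1)) (by positivity)
  refine ⟨δ, hδ, fun E hE hlt => ?_⟩
  have hK : (0 : ℝ) < K + 1 := by positivity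
  have h1 := H E hE hlt
  rw [lt_div_iff₀ hK, mul_comm] at h1
  refine lt_of_le_of_lt ?_ h1
  rw [Finset.mul_sum]
  refine Finset.sum_le_sum fun i hi => ?_
  have := hE.1 i hi
  refine (h.dist_le_mul _ (mem_image_of_mem _ this.1) _ (mem_image_of_mem _ this.2)).trans ?_
  gcongr
  linarith

namespace HasACDeriv

variable {F F' G G' : ℝ → ℝ} {a b c d : ℝ}

theorem congr_deriv (h : HasACDeriv F F' a b) (hae : ∀ᵐ x, x ∈ uIcc a b → F' x = G' x) :
    HasACDeriv F G' a b := by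
  refine ⟨h.1, ?_⟩
  filter_upwards [h.2, hae] with x h1 h2 hx
  exact h2 hx ▸ h1 hx

theorem congr_deriv_on (h : HasACDeriv F F' a b) (he : EqOn F' G' (uIcc a b)) :
    HasACDeriv F G' a b :=
  h.congr_deriv (ae_of_all _ fun _ hx => he hx)

theorem congr (h : HasACDeriv F F' a b) (he : EqOn F G (uIcc a b)) : HasACDeriv G F' a b := by
  refine ⟨h.1.congr he, ?_⟩
  filter_upwards [h.2, ae_mem_uIcc_imp_mem_uIoo a b] with x h1 h2 hx
  refine (h1 hx).congr_of_eventuallyEq ?_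
  filter_upwards [isOpen_Ioo.mem_nhds (h2 hx)] with y hy
  exact (he (Ioo_subset_Icc_self hy)).symm

theorem mono (h : HasACDeriv F F' a b) (hs : uIcc c d ⊆ uIcc a b) : HasACDeriv F F' c d :=
  ⟨h.1.mono hs, h.2.mono fun _ hx hxs => hx (hs hxs)⟩

theorem continuousOn (h : HasACDeriv F F' a b) : ContinuousOn F (uIcc a b) := h.1.continuousOn

theorem integral (h : IntervalIntegrable F' volume a b) (hc : c ∈ uIcc a b) (k : ℝ) :
    HasACDeriv (fun t => k + ∫ s in c..t, F' s) F' a b := by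
  constructor
  · have h1 := h.absolutelyContinuousOnInterval_intervalIntegral hc
    have h2 : AbsolutelyContinuousOnInterval (fun _ : ℝ => k) a b :=
      (LipschitzWith.const k).lipschitzOnWith.absolutelyContinuousOnInterval (K := 0)
    exact h2.fun_add h1
  · filter_upwards [h.ae_hasDerivAt_integral] with x hx hxs
    exact (hx hxs c hc).const_add k

theorem of_integral (h : IntervalIntegrable F' volume a b) (hc : c ∈ uIcc a b) {k : ℝ}
    (hF : ∀ t ∈ uIcc a b, F t = k + ∫ s in c..t, F' s) : HasACDeriv F F' a b :=
  (integral h hc k).congr fun t ht => (hF t ht).symm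

theorem intervalIntegrable (h : HasACDeriv F F' a b) : IntervalIntegrable F' volume a b := by
  refine h.1.intervalIntegrable_deriv.congr_ae ?_
  rw [EventuallyEq, ae_restrict_iff' measurableSet_uIoc]
  filter_upwards [h.2] with x hx hxs
  exact (hx (uIoc_subset_uIcc hxs)).deriv

theorem integral_eq_sub (h : HasACDeriv F F' a b) : ∫ s in a..b, F' s = F b - F a := by
  rw [← h.1.integral_deriv_eq_sub]
  refine intervalIntegral.integral_congr_ae ?_
  filter_upwards [h.2] with x hx hxs
  exact (hx (uIoc_subset_uIcc hxs)).deriv.symm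

theorem integral_eq_sub_of_mem (h : HasACDeriv F F' a b) (hc : c ∈ uIcc a b) (hd : d ∈ uIcc a b) :
    ∫ s in c..d, F' s = F d - F c :=
  (h.mono (uIcc_subset_uIcc hc hd)).integral_eq_sub

theorem const (k : ℝ) : HasACDeriv (fun _ => k) (fun _ => 0) a b :=
  ⟨(LipschitzWith.const k).lipschitzOnWith.absolutelyContinuousOnInterval (K := 0),
    ae_of_all _ fun x _ => hasDerivAt_const x k⟩

theorem add (hF : HasACDeriv F F' a b) (hG : HasACDeriv G G' a b) :
    HasACDeriv (fun t => F t + G t) (fun t => F' t + G' t) a b := by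
  refine ⟨hF.1.fun_add hG.1, ?_⟩
  filter_upwards [hF.2, hG.2] with x h1 h2 hx
  exact (h1 hx).add (h2 hx)

theorem neg (hF : HasACDeriv F F' a b) : HasACDeriv (fun t => -F t) (fun t => -F' t) a b := by
  refine ⟨hF.1.fun_neg, ?_⟩
  filter_upwards [hF.2] with x h1 hx
  exact (h1 hx).neg

theorem sub (hF : HasACDeriv F F' a b) (hG : HasACDeriv G G' a b) :
    HasACDeriv (fun t => F t - G t) (fun t => F' t - G' t) a b := by
  simpa only [sub_eq_add_neg] using hF.add hG.neg

theorem mul (hF : HasACDeriv F F' a b) (hG : HasACDeriv G G' a b) :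
    HasACDeriv (fun t => F t * G t) (fun t => F' t * G t + F t * G' t) a b := by
  refine ⟨hF.1.fun_mul hG.1, ?_⟩
  filter_upwards [hF.2, hG.2] with x h1 h2 hx
  exact (h1 hx).mul (h2 hx)

theorem const_mul (k : ℝ) (hF : HasACDeriv F F' a b) :
    HasACDeriv (fun t => k * F t) (fun t => k * F' t) a b := by
  simpa using (const k).mul hF

/-- The image of the interval is compact and convex, so the bounded derivative makes `φ` Lipschitz
there, and Lipschitz maps preserve absolute continuity. -/
theorem comp {φ φ' : ℝ → ℝ} (hF : HasACDeriv F F' a b)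
    (hφ : ∀ x ∈ uIcc a b, HasDerivAt φ (φ' (F x)) (F x))
    (hφ' : ContinuousOn φ' (F '' uIcc a b)) :
    HasACDeriv (fun t => φ (F t)) (fun t => φ' (F t) * F' t) a b := by
  constructor
  · have hcomp : IsCompact (F '' uIcc a b) := isCompact_uIcc.image_of_continuousOn hF.continuousOn
    have hconv : Convex ℝ (F '' uIcc a b) :=
      (isPreconnected_uIcc.image _ hF.continuousOn).ordConnected.convex
    obtain ⟨C, hC⟩ := hcomp.exists_bound_of_continuousOn hφ'
    refine hF.1.lipschitz_comp (K := C.toNNReal)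
      (hconv.lipschitzOnWith_of_nnnorm_hasDerivWithin_le (f' := φ') ?_ ?_)
    · rintro _ ⟨x, hx, rfl⟩
      exact (hφ x hx).hasDerivWithinAt
    · rintro y hy
      rw [← NNReal.coe_le_coe, coe_nnnorm]
      exact (hC y hy).trans (Real.le_coe_toNNReal C)
  · filter_upwards [hF.2] with x h1 hx
    exact (hφ x hx).comp x (h1 hx)

theorem exp (hF : HasACDeriv F F' a b) :
    HasACDeriv (fun t => Real.exp (F t)) (fun t => Real.exp (F t) * F' t) a b :=
  hF.comp (fun _ _ => Real.hasDerivAt_exp _) Real.continuous_exp.continuousOn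

theorem inv (hF : HasACDeriv F F' a b) (h0 : ∀ x ∈ uIcc a b, F x ≠ 0) :
    HasACDeriv (fun t => (F t)⁻¹) (fun t => -(F t ^ 2)⁻¹ * F' t) a b := by
  refine hF.comp (φ' := fun y => -(y ^ 2)⁻¹) (fun x hx => hasDerivAt_inv (h0 x hx)) ?_
  refine ((continuousOn_id.pow 2).inv₀ ?_).neg
  rintro _ ⟨x, hx, rfl⟩
  exact pow_ne_zero 2 (h0 x hx)

theorem div (hF : HasACDeriv F F' a b) (hG : HasACDeriv G G' a b) (h0 : ∀ x ∈ uIcc a b, G x ≠ 0) :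
    HasACDeriv (fun t => F t / G t) (fun t => (F' t * G t - F t * G' t) / G t ^ 2) a b := by
  simp only [div_eq_mul_inv]
  refine (hF.mul (hG.inv h0)).congr_deriv_on fun x hx => ?_
  have := h0 x hx
  field_simp
  ring

theorem eq_of_deriv_zero (hF : HasACDeriv F (fun _ => 0) a b) (hc : c ∈ uIcc a b)
    (hd : d ∈ uIcc a b) : F c = F d := by
  have := hF.integral_eq_sub_of_mem hc hd
  rw [intervalIntegral.integral_zero] at this
  linarith

theorem le_of_deriv_nonneg (hF : HasACDeriv F F' a b) (h0 : ∀ᵐ x, x ∈ uIcc a b → 0 ≤ F' x)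
    (hc : c ∈ uIcc a b) (hd : d ∈ uIcc a b) (hcd : c ≤ d) : F c ≤ F d := by
  have h1 := hF.integral_eq_sub_of_mem hc hd
  have h2 : 0 ≤ ∫ s in c..d, F' s := by
    refine intervalIntegral.integral_nonneg_of_ae_restrict hcd ?_
    refine (ae_restrict_iff' measurableSet_Icc).2 ?_
    filter_upwards [h0] with x hx hxs
    exact hx (uIcc_subset_uIcc hc hd (Icc_subset_uIcc hxs))
  linarith

theorem of_contDiffOn (hab : a < b) (hF : ContDiffOn ℝ 1 F (Icc a b)) :
    HasACDeriv F (derivWithin F (Icc a b)) a b := by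
  rw [← uIcc_of_le hab.le] at hF ⊢
  refine ⟨hF.absolutelyContinuousOnInterval, ?_⟩
  filter_upwards [ae_mem_uIcc_imp_mem_uIoo a b] with x hx hxs
  exact ((hF.differentiableOn one_ne_zero x hxs).hasDerivWithinAt).hasDerivAt
    (mem_of_superset (isOpen_Ioo.mem_nhds (hx hxs)) Ioo_subset_Icc_self)

end HasACDeriv

/-! ### Planar linear systems: existence, conserved quantities, positivity -/

theorem integral_exp_mul_le {L s : ℝ} (hL : 0 < L) :
    ∫ r in (0 : ℝ)..s, Real.exp (L * r) ≤ Real.exp (L * s) / L := by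
  rw [intervalIntegral.integral_comp_mul_left (fun x => Real.exp x) hL.ne', integral_exp]
  simp only [smul_eq_mul, mul_zero, Real.exp_zero]
  rw [div_eq_inv_mul]
  have := inv_pos.2 hL
  nlinarith

theorem abs_integral_mul_le {f g : ℝ → ℝ} {s C D L : ℝ} (hs : 0 ≤ s) (hL : 0 < L)
    (hC : 0 ≤ C) (hf : ∀ᵐ r, |f r| ≤ C) (hg : ∀ r ∈ Icc 0 s, |g r| ≤ D * Real.exp (L * r)) :
    |∫ r in (0 : ℝ)..s, f r * g r| ≤ C * D * (Real.exp (L * s) / L) := by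
  have hD : 0 ≤ D := by
    have := (abs_nonneg _).trans (hg 0 ⟨le_rfl, hs⟩)
    simpa using this
  have h1 : ‖∫ r in (0 : ℝ)..s, f r * g r‖ ≤ ∫ r in (0 : ℝ)..s, C * D * Real.exp (L * r) := by
    refine intervalIntegral.norm_integral_le_of_norm_le hs ?_
      (Continuous.intervalIntegrable (by fun_prop) _ _)
    filter_upwards [hf] with r hr hrs
    rw [norm_mul, mul_assoc]
    exact mul_le_mul hr (hg r (Ioc_subset_Icc_self hrs)) (norm_nonneg _) hC
  refine h1.trans ?_
  rw [intervalIntegral.integral_const_mul]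
  exact mul_le_mul_of_nonneg_left (integral_exp_mul_le hL) (mul_nonneg hC hD)

/-- Banach's fixed point theorem on `C([0,T])`, after eliminating the second unknown. The unknown is
`y = exp(-L t) U`, so that the contraction holds on all of `[0,T]` at once. -/
theorem exists_volterra_fixedPoint {β γ : ℝ → ℝ} {T B : ℝ} (hT : 0 ≤ T) (hB : 0 ≤ B)
    (hβ : Integrable β) (hγ : Integrable γ) (hβB : ∀ᵐ t, |β t| ≤ B) (hγB : ∀ᵐ t, |γ t| ≤ B)
    (a b : ℝ) :
    ∃ U : ℝ → ℝ, Continuous U ∧ ∀ t ∈ Icc 0 T,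
      U t = a + ∫ s in (0 : ℝ)..t, β s * (b + ∫ r in (0 : ℝ)..s, γ r * U r) := by
  -- Each of the two nested integrations costs a factor `B / L` in the weighted norm; this `L` makes
  -- the product at most `1/2`.
  set L : ℝ := 2 * B * B + 1 with hL
  have hLpos : 0 < L := by positivity
  have hLsq : B * B / L / L ≤ 1 / 2 := by
    rw [div_div, div_le_div_iff₀ (by positivity) (by norm_num)]
    nlinarith [mul_nonneg hB hB]
  let e : C(Icc (0 : ℝ) T, ℝ) → ℝ → ℝ := fun y r => Real.exp (L * r) * IccExtend hT y r
  have he : ∀ y, Continuous (e y) := fun y => by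
    have : Continuous (IccExtend hT y) := y.continuous.Icc_extend'
    fun_prop
  have hγi : ∀ y c d, IntervalIntegrable (fun r => γ r * e y r) volume c d := fun y c d =>
    hγ.intervalIntegrable.mul_continuousOn (he y).continuousOn
  let V : C(Icc (0 : ℝ) T, ℝ) → ℝ → ℝ := fun y s => b + ∫ r in (0 : ℝ)..s, γ r * e y r
  have hV : ∀ y, Continuous (V y) := fun y =>
    continuous_const.add (intervalIntegral.continuous_primitive (hγi y) 0)
  have hβi : ∀ y c d, IntervalIntegrable (fun s => β s * V y s) volume c d := fun y c d =>
    hβ.intervalIntegrable.mul_continuousOn (hV y).continuousOn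
  let Φ : C(Icc (0 : ℝ) T, ℝ) → ℝ → ℝ := fun y t => a + ∫ s in (0 : ℝ)..t, β s * V y s
  have hΦ : ∀ y, Continuous (Φ y) := fun y =>
    continuous_const.add (intervalIntegral.continuous_primitive (hβi y) 0)
  let Ψ : C(Icc (0 : ℝ) T, ℝ) → C(Icc (0 : ℝ) T, ℝ) := fun y =>
    ⟨fun t => Real.exp (-(L * t)) * Φ y t, by have := hΦ y; fun_prop⟩
  have hΨ : ContractingWith (1 / 2) Ψ := by
    refine ⟨by norm_num, LipschitzWith.of_dist_le_mul fun y z => ?_⟩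
    rw [ContinuousMap.dist_le (by positivity)]
    rintro ⟨t, ht⟩
    have hd : ∀ r, |e y r - e z r| ≤ dist y z * Real.exp (L * r) := fun r => by
      simp only [e, ← mul_sub, abs_mul, Real.abs_exp]
      rw [mul_comm]
      gcongr
      exact ContinuousMap.dist_apply_le_dist (f := y) (g := z) _
    have hVd : ∀ s ∈ Icc 0 t, |V y s - V z s| ≤ (B * dist y z / L) * Real.exp (L * s) := by
      intro s hs
      have : V y s - V z s = ∫ r in (0 : ℝ)..s, γ r * (e y r - e z r) := by
        simp only [V, mul_sub]
        rw [intervalIntegral.integral_sub (hγi y _ _) (hγi z _ _)]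
        ring
      rw [this]
      refine (abs_integral_mul_le hs.1 hLpos hB hγB fun r _ => hd r).trans_eq ?_
      ring
    have hΦd : |Φ y t - Φ z t| ≤ (B * B / L / L) * dist y z * Real.exp (L * t) := by
      have : Φ y t - Φ z t = ∫ r in (0 : ℝ)..t, β r * (V y r - V z r) := by
        simp only [Φ, mul_sub]
        rw [intervalIntegral.integral_sub (hβi y _ _) (hβi z _ _)]
        ring
      rw [this]
      refine (abs_integral_mul_le ht.1 hLpos hB hβB hVd).trans_eq ?_
      ring
    calc dist (Ψ y ⟨t, ht⟩) (Ψ z ⟨t, ht⟩)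
        = Real.exp (-(L * t)) * |Φ y t - Φ z t| := by
          simp only [Ψ, ContinuousMap.coe_mk, Real.dist_eq, ← mul_sub, abs_mul, Real.abs_exp]
      _ ≤ Real.exp (-(L * t)) * ((B * B / L / L) * dist y z * Real.exp (L * t)) := by gcongr
      _ = (B * B / L / L) * dist y z * (Real.exp (-(L * t)) * Real.exp (L * t)) := by ring
      _ = (B * B / L / L) * dist y z := by rw [← Real.exp_add]; simp
      _ ≤ 1 / 2 * dist y z := by gcongr
  obtain ⟨y, hy⟩ : ∃ y, Ψ y = y := ⟨_, hΨ.fixedPoint_isFixedPt⟩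
  have key : ∀ t ∈ Icc 0 T, e y t = Φ y t := by
    intro t ht
    have h1 : Real.exp (-(L * t)) * Φ y t = y ⟨t, ht⟩ := congrArg (fun f => f ⟨t, ht⟩) hy
    simp only [e]
    rw [IccExtend_of_mem hT y ht, ← h1, ← mul_assoc, ← Real.exp_add]
    simp
  exact ⟨e y, he y, key⟩

/-- `(U, W)` solves the linear system `U' = β W`, `W' = γ U` on `[0,T]`. -/
structure IsLinSol (β γ : ℝ → ℝ) (T : ℝ) (U W : ℝ → ℝ) : Prop where
  left : HasACDeriv U (fun t => β t * W t) 0 T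
  right : HasACDeriv W (fun t => γ t * U t) 0 T

theorem MeasureTheory.MemLp.exists_bound_indicator {f : ℝ → ℝ} {s : Set ℝ} (hs : MeasurableSet s)
    (hf : MemLp f ⊤ (volume.restrict s)) : ∃ C, 0 ≤ C ∧ ∀ᵐ t, |s.indicator f t| ≤ C := by
  have h1 := hf.2
  rw [eLpNorm_exponent_top] at h1
  refine ⟨(eLpNormEssSup f (volume.restrict s)).toReal, ENNReal.toReal_nonneg, ?_⟩
  filter_upwards [(ae_restrict_iff' hs).1
    (ae_le_eLpNormEssSup (f := f) (μ := volume.restrict s))] with t ht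
  by_cases hts : t ∈ s
  · rw [indicator_of_mem hts, ← Real.norm_eq_abs, ← toReal_enorm]
    exact ENNReal.toReal_mono h1.ne (ht hts)
  · rw [indicator_of_notMem hts, abs_zero]
    exact ENNReal.toReal_nonneg

theorem ContinuousOn.memLp_top_Icc {f : ℝ → ℝ} {a b : ℝ} (hf : ContinuousOn f (Icc a b)) :
    MemLp f ⊤ (volume.restrict (Icc a b)) := by
  obtain ⟨C, hC⟩ := isCompact_Icc.exists_bound_of_continuousOn hf
  exact memLp_top_of_bound (hf.aestronglyMeasurable measurableSet_Icc) C
    ((ae_restrict_iff' measurableSet_Icc).2 (ae_of_all _ hC))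

theorem MeasureTheory.MemLp.intervalIntegrable_of_top {f : ℝ → ℝ} {a b : ℝ} (hab : a ≤ b)
    (hf : MemLp f ⊤ (volume.restrict (Icc a b))) : IntervalIntegrable f volume a b :=
  (intervalIntegrable_iff_integrableOn_Icc_of_le hab).2 (hf.integrable le_top)

theorem exists_isLinSol {β γ : ℝ → ℝ} {T : ℝ} (hT : 0 ≤ T)
    (hβ : MemLp β ⊤ (volume.restrict (Icc 0 T))) (hγ : MemLp γ ⊤ (volume.restrict (Icc 0 T)))
    (a b : ℝ) : ∃ U W, IsLinSol β γ T U W ∧ U 0 = a ∧ W 0 = b := by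
  obtain ⟨B₁, hB₁, h₁⟩ := hβ.exists_bound_indicator measurableSet_Icc
  obtain ⟨B₂, hB₂, h₂⟩ := hγ.exists_bound_indicator measurableSet_Icc
  obtain ⟨U, hUc, hU⟩ := exists_volterra_fixedPoint hT (le_max_of_le_left hB₁ : 0 ≤ max B₁ B₂)
    ((integrable_indicator_iff measurableSet_Icc).2 (hβ.integrable le_top))
    ((integrable_indicator_iff measurableSet_Icc).2 (hγ.integrable le_top))
    (h₁.mono fun _ h => h.trans (le_max_left _ _)) (h₂.mono fun _ h => h.trans (le_max_right _ _))
    a b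
  have hγU : IntervalIntegrable (fun t => γ t * U t) volume 0 T :=
    (hγ.intervalIntegrable_of_top hT).mul_continuousOn hUc.continuousOn
  have hW := HasACDeriv.integral hγU left_mem_uIcc b
  have hβW : IntervalIntegrable (fun t => β t * (b + ∫ r in (0 : ℝ)..t, γ r * U r)) volume 0 T :=
    (hβ.intervalIntegrable_of_top hT).mul_continuousOn hW.continuousOn
  refine ⟨U, fun t => b + ∫ r in (0 : ℝ)..t, γ r * U r, ⟨?_, hW⟩, ?_, by simp⟩
  · refine HasACDeriv.of_integral hβW left_mem_uIcc (k := a) fun t ht => ?_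
    rw [uIcc_of_le hT] at ht
    rw [hU t ht]
    congr 1
    refine intervalIntegral.integral_congr fun s hs => ?_
    rw [uIcc_of_le ht.1] at hs
    have hsT : s ∈ Icc 0 T := ⟨hs.1, hs.2.trans ht.2⟩
    simp only [indicator_of_mem hsT]
    congr 2
    refine intervalIntegral.integral_congr fun r hr => ?_
    rw [uIcc_of_le hs.1] at hr
    simp only [indicator_of_mem (show r ∈ Icc 0 T from ⟨hr.1, hr.2.trans hsT.2⟩)]
  · simpa using hU 0 ⟨le_rfl, hT⟩

namespace IsLinSol

variable {β γ U W U₁ W₁ : ℝ → ℝ} {T : ℝ}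

theorem wronskian (h : IsLinSol β γ T U W) (h₁ : IsLinSol β γ T U₁ W₁) {s t : ℝ}
    (hs : s ∈ uIcc 0 T) (ht : t ∈ uIcc 0 T) :
    U s * W₁ s - W s * U₁ s = U t * W₁ t - W t * U₁ t :=
  (((h.left.mul h₁.right).sub (h.right.mul h₁.left)).congr_deriv_on
    (G' := fun _ => 0) fun x _ => by ring).eq_of_deriv_zero hs ht

/-- Changing the sign of `W₁` turns the negated system into the original one, so this is again a
Wronskian. -/
theorem pairing (h : IsLinSol β γ T U W)
    (h₁ : IsLinSol (fun t => -β t) (fun t => -γ t) T U₁ W₁) {s t : ℝ}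
    (hs : s ∈ uIcc 0 T) (ht : t ∈ uIcc 0 T) :
    U₁ s * W s + W₁ s * U s = U₁ t * W t + W₁ t * U t :=
  (((h₁.left.mul h.right).add (h₁.right.mul h.left)).congr_deriv_on
    (G' := fun _ => 0) fun x _ => by ring).eq_of_deriv_zero hs ht

/-- Since `(U W)' = β W² + γ U² ≥ 0`, the product stays nonnegative; hence `(W²)' = 2 γ U W ≥ 0` and
`W` cannot reach zero. Then `U = ∫ β W > 0`. -/
theorem pos_of_left_zero (h : IsLinSol β γ T U W) (hT : 0 ≤ T)
    (hβ : ∀ t ∈ Icc 0 T, 0 < β t) (hγ : ∀ᵐ t, t ∈ Icc 0 T → 0 ≤ γ t) (hU : U 0 = 0)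
    (hW : 0 < W 0) : (∀ t ∈ Icc 0 T, 0 < W t) ∧ ∀ t ∈ Ioc 0 T, 0 < U t := by
  have hI : uIcc 0 T = Icc 0 T := uIcc_of_le hT
  have h0 : (0 : ℝ) ∈ uIcc 0 T := left_mem_uIcc
  have hUW : ∀ t ∈ Icc 0 T, 0 ≤ U t * W t := by
    intro t ht
    have := (h.left.mul h.right).le_of_deriv_nonneg (c := 0) (d := t) ?_ h0 (hI ▸ ht) ht.1
    · simpa [hU] using this
    · filter_upwards [hγ] with x hx hxs
      rw [hI] at hxs
      have h1 := mul_nonneg (hβ x hxs).le (mul_self_nonneg (W x))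
      have h2 := mul_nonneg (hx hxs) (mul_self_nonneg (U x))
      nlinarith
  have hW2 : ∀ t ∈ Icc 0 T, W 0 * W 0 ≤ W t * W t := by
    intro t ht
    refine (h.right.mul h.right).le_of_deriv_nonneg (c := 0) (d := t) ?_ h0 (hI ▸ ht) ht.1
    filter_upwards [hγ] with x hx hxs
    rw [hI] at hxs
    have h2 := mul_nonneg (hx hxs) (hUW x hxs)
    nlinarith
  have hWpos : ∀ t ∈ Icc 0 T, 0 < W t := by
    intro t ht
    by_contra hneg
    have hc : ContinuousOn W (Icc 0 t) :=
      (hI ▸ h.right.continuousOn).mono (Icc_subset_Icc_right ht.2)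
    obtain ⟨s, hs, hs0⟩ := intermediate_value_Icc' ht.1 hc ⟨not_lt.1 hneg, hW.le⟩
    have := hW2 s ⟨hs.1, hs.2.trans ht.2⟩
    rw [hs0] at this
    nlinarith
  refine ⟨hWpos, fun t ht => ?_⟩
  have htT : t ∈ uIcc 0 T := hI ▸ Ioc_subset_Icc_self ht
  have h1 := h.left.integral_eq_sub_of_mem h0 htT
  rw [hU, sub_zero] at h1
  rw [← h1]
  refine intervalIntegral.intervalIntegral_pos_of_pos_on
    (h.left.intervalIntegrable.mono_set (uIcc_subset_uIcc h0 htT)) (fun x hx => ?_) ht.1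
  have hxT : x ∈ Icc 0 T := ⟨hx.1.le, hx.2.le.trans ht.2⟩
  exact mul_pos (hβ x hxT) (hWpos x hxT)

theorem pos_of_right_zero (h : IsLinSol (fun t => -β t) (fun t => -γ t) T U W) (hT : 0 ≤ T)
    (hβ : ∀ t ∈ Icc 0 T, 0 < β t) (hγ : ∀ᵐ t, t ∈ Icc 0 T → 0 ≤ γ t) (hU : U T = 0)
    (hW : 0 < W T) : (∀ t ∈ Icc 0 T, 0 < W t) ∧ ∀ t ∈ Ico 0 T, 0 < U t := by
  have hI : uIcc 0 T = Icc 0 T := uIcc_of_le hT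
  have hTm : T ∈ uIcc 0 T := right_mem_uIcc
  have hUW : ∀ t ∈ Icc 0 T, 0 ≤ U t * W t := by
    intro t ht
    have := (h.left.mul h.right).neg.le_of_deriv_nonneg (c := t) (d := T) ?_ (hI ▸ ht) hTm ht.2
    · simpa [hU] using this
    · filter_upwards [hγ] with x hx hxs
      rw [hI] at hxs
      have h1 := mul_nonneg (hβ x hxs).le (mul_self_nonneg (W x))
      have h2 := mul_nonneg (hx hxs) (mul_self_nonneg (U x))
      nlinarith
  have hW2 : ∀ t ∈ Icc 0 T, W T * W T ≤ W t * W t := by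
    intro t ht
    have := (h.right.mul h.right).neg.le_of_deriv_nonneg (c := t) (d := T) ?_ (hI ▸ ht) hTm ht.2
    · linarith
    filter_upwards [hγ] with x hx hxs
    rw [hI] at hxs
    have h2 := mul_nonneg (hx hxs) (hUW x hxs)
    nlinarith
  have hWpos : ∀ t ∈ Icc 0 T, 0 < W t := by
    intro t ht
    by_contra hneg
    have hc : ContinuousOn W (Icc t T) :=
      (hI ▸ h.right.continuousOn).mono (Icc_subset_Icc_left ht.1)
    obtain ⟨s, hs, hs0⟩ := intermediate_value_Icc ht.2 hc ⟨not_lt.1 hneg, hW.le⟩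
    have := hW2 s ⟨ht.1.trans hs.1, hs.2⟩
    rw [hs0] at this
    nlinarith
  refine ⟨hWpos, fun t ht => ?_⟩
  have htT : t ∈ uIcc 0 T := hI ▸ Ico_subset_Icc_self ht
  have h1 := h.left.neg.integral_eq_sub_of_mem htT hTm
  rw [hU, neg_zero, zero_sub, neg_neg] at h1
  rw [← h1]
  refine intervalIntegral.intervalIntegral_pos_of_pos_on
    (h.left.neg.intervalIntegrable.mono_set (uIcc_subset_uIcc htT hTm)) (fun x hx => ?_) ht.2
  have hxT : x ∈ Icc 0 T := ⟨ht.1.trans hx.1.le, hx.2.le⟩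
  have := mul_pos (hβ x hxT) (hWpos x hxT)
  linarith

end IsLinSol

/-- A fundamental system of `U' = β W`, `W' = γ U`: the solution `(h, p)` started from `(0, 1)` at
time `0`, and the solution `(u, -w)` that ends in `(0, -1)` at time `T`. -/
structure IsFundamental (β γ : ℝ → ℝ) (T : ℝ) (h p u w : ℝ → ℝ) : Prop where
  fwd : IsLinSol β γ T h p
  bwd : IsLinSol (fun t => -β t) (fun t => -γ t) T u w
  h_zero : h 0 = 0
  p_zero : p 0 = 1
  u_T : u T = 0
  w_T : w T = 1
  h_pos : ∀ t ∈ Ioc 0 T, 0 < h t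
  w_pos : ∀ t ∈ Icc 0 T, 0 < w t
  u_pos : ∀ t ∈ Ico 0 T, 0 < u t

theorem exists_isFundamental {β γ : ℝ → ℝ} {T : ℝ} (hT : 0 ≤ T)
    (hβc : ContinuousOn β (Icc 0 T)) (hβ : ∀ t ∈ Icc 0 T, 0 < β t)
    (hγm : MemLp γ ⊤ (volume.restrict (Icc 0 T))) (hγ : ∀ᵐ t, t ∈ Icc 0 T → 0 ≤ γ t) :
    ∃ h p u w, IsFundamental β γ T h p u w := by
  obtain ⟨h, p, hp, h0, p0⟩ := exists_isLinSol hT hβc.memLp_top_Icc hγm 0 1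
  obtain ⟨c, s, cs, c0, s0⟩ := exists_isLinSol hT hβc.memLp_top_Icc hγm 1 0
  have hW : c T * p T - s T * h T = 1 := by
    rw [cs.wronskian hp right_mem_uIcc left_mem_uIcc, c0, s0, h0, p0]
    simp
  -- The combination of the solutions from `(1, 0)` and `(0, 1)` whose first component vanishes at
  -- `T`; its second component at `T` is their Wronskian, which is `1`.
  have huw : IsLinSol (fun t => -β t) (fun t => -γ t) T (fun t => h T * c t - c T * h t)
      (fun t => c T * p t - h T * s t) :=
    ⟨((cs.left.const_mul _).sub (hp.left.const_mul _)).congr_deriv_on fun x _ => by ring,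
      ((hp.right.const_mul _).sub (cs.right.const_mul _)).congr_deriv_on fun x _ => by ring⟩
  have hpos := hp.pos_of_left_zero hT hβ hγ h0 (by rw [p0]; exact one_pos)
  have hwT : c T * p T - h T * s T = 1 := by linarith
  have upos := huw.pos_of_right_zero hT hβ hγ (by ring) (by rw [hwT]; exact one_pos)
  exact ⟨h, p, _, _, hp, huw, h0, p0, by ring, hwT, hpos.2, upos.1, upos.2⟩

namespace IsFundamental

variable {β γ h p u w : ℝ → ℝ} {T : ℝ}

theorem det (H : IsFundamental β γ T h p u w) {t : ℝ} (ht : t ∈ uIcc 0 T) :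
    u t * p t + w t * h t = h T := by
  rw [H.fwd.pairing H.bwd ht right_mem_uIcc, H.u_T, H.w_T]
  ring

theorem u_zero (H : IsFundamental β γ T h p u w) : u 0 = h T := by
  have := H.det left_mem_uIcc
  rw [H.h_zero, H.p_zero] at this
  linarith

/-- The Wronskian with `(u, w)` vanishes because both first components vanish at `T`; the pairing
with `(h, p)` fixes the multiple. The two relations are solved with the determinant `h T ≠ 0`. -/
theorem eq_smul (H : IsFundamental β γ T h p u w) (hT : 0 < T) {U W : ℝ → ℝ}
    (hUW : IsLinSol (fun t => -β t) (fun t => -γ t) T U W) (hU : U T = 0) {t : ℝ}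
    (ht : t ∈ uIcc 0 T) : U t = W T * u t ∧ W t = W T * w t := by
  have h1 := hUW.wronskian H.bwd ht right_mem_uIcc
  have h2 := H.fwd.pairing hUW ht right_mem_uIcc
  have h3 := H.det ht
  have h4 := H.h_pos T ⟨hT, le_rfl⟩
  rw [H.u_T, hU] at h1
  rw [hU] at h2
  constructor <;> refine mul_left_cancel₀ h4.ne' ?_
  · linear_combination u t * h2 + h t * h1 - U t * h3
  · linear_combination w t * h2 - p t * h1 - W t * h3

end IsFundamental

theorem MeasureTheory.MemLp.mul_top {f g : ℝ → ℝ} {s : Set ℝ}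
    (hf : MemLp f ⊤ (volume.restrict s)) (hg : MemLp g ⊤ (volume.restrict s)) :
    MemLp (fun t => f t * g t) ⊤ (volume.restrict s) :=
  hg.mul' hf

/-- If `m' = -z`, `z' = -(a m + b z)` with `a ≥ 0` and `m T = 0`, then `z` does not change sign,
and the sign of `z` is that of `m 0`. -/
theorem sign_eq_of_damped {a b m z : ℝ → ℝ} {T : ℝ} (hT : 0 < T)
    (ha : MemLp a ⊤ (volume.restrict (Icc 0 T))) (ha0 : ∀ᵐ t, t ∈ Icc 0 T → 0 ≤ a t)
    (hb : MemLp b ⊤ (volume.restrict (Icc 0 T)))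
    (hm : HasACDeriv m (fun t => -z t) 0 T)
    (hz : HasACDeriv z (fun t => -(a t * m t + b t * z t)) 0 T) (hmT : m T = 0) :
    (∀ t ∈ Icc 0 T, SignType.sign (z t) = SignType.sign (z T)) ∧
      SignType.sign (m 0) = SignType.sign (z T) := by
  have hI : uIcc 0 T = Icc 0 T := uIcc_of_le hT.le
  -- The integrating factor `B` absorbs the damping: `(m, z B)` solves the negated system with
  -- coefficients `1 / B` and `a B`. As `m T = 0`, it is a multiple of `(u, w)`, whose positivity
  -- transfers the sign of that multiple to `z` and to `m 0`.
  set B : ℝ → ℝ := fun t => Real.exp (0 + ∫ s in (0 : ℝ)..t, b s) with hB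
  have hBd : HasACDeriv B (fun t => B t * b t) 0 T :=
    (HasACDeriv.integral (hb.intervalIntegrable_of_top hT.le) left_mem_uIcc 0).exp
  have hBc : ContinuousOn B (Icc 0 T) := hI ▸ hBd.continuousOn
  have hBpos : ∀ t, 0 < B t := fun t => Real.exp_pos _
  have hβc : ContinuousOn (fun t => (B t)⁻¹) (Icc 0 T) := hBc.inv₀ fun t _ => (hBpos t).ne'
  obtain ⟨h, p, u, w, H⟩ := exists_isFundamental (γ := fun t => a t * B t) hT.le hβc
    (fun t _ => inv_pos.2 (hBpos t)) (ha.mul_top hBc.memLp_top_Icc)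
    (ha0.mono fun t h ht => mul_nonneg (h ht) (hBpos t).le)
  have hsol : IsLinSol (fun t => -(B t)⁻¹) (fun t => -(a t * B t)) T m (fun t => z t * B t) :=
    ⟨hm.congr_deriv_on fun t _ => by have := (hBpos t).ne'; field_simp,
      (hz.mul hBd).congr_deriv_on fun t _ => by ring⟩
  have key := fun t (ht : t ∈ Icc 0 T) => H.eq_smul hT hsol hmT (hI ▸ ht)
  have hsignB : ∀ t, SignType.sign (B t) = 1 := fun t => sign_pos (hBpos t)
  constructor
  · intro t ht
    have h1 := congrArg SignType.sign (key t ht).2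
    simpa only [sign_mul, hsignB, mul_one, sign_pos (H.w_pos t ht)] using h1
  · have h1 := congrArg SignType.sign (key 0 ⟨le_rfl, hT.le⟩).1
    simpa only [sign_mul, hsignB, mul_one, sign_pos (H.u_pos 0 ⟨le_rfl, hT⟩)] using h1

/-! ### The Riccati equation and the identification of `h` and `α` -/

namespace Liquidation

namespace Params

variable (P : Params)

/-- The integrating factor `exp (∫₀ᵗ δ κ / η)`. -/
def G (t : ℝ) : ℝ := Real.exp (0 + ∫ s in (0 : ℝ)..t, P.δ * P.κ s / P.η s)

/-- The coefficient `1 / (η G)` of the normalized linear system. -/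
def β (t : ℝ) : ℝ := 1 / (P.η t * P.G t)

/-- The coefficient `λ G` of the normalized linear system. -/
def γ (t : ℝ) : ℝ := P.lam t * P.G t

variable {P}

theorem G_pos (t : ℝ) : 0 < P.G t := Real.exp_pos _

theorem G_zero : P.G 0 = 1 := by simp [G]

namespace Admissible

variable (hP : P.Admissible)
include hP

theorem uIcc_eq : uIcc 0 P.T = Icc 0 P.T := uIcc_of_le hP.T_pos.le

theorem continuousOn_η : ContinuousOn P.η (Icc 0 P.T) := hP.η_contDiff.continuousOn

theorem continuousOn_κ : ContinuousOn P.κ (Icc 0 P.T) := hP.κ_contDiff.continuousOn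

theorem continuousOn_inv_η : ContinuousOn (fun t => (P.η t)⁻¹) (Icc 0 P.T) :=
  hP.continuousOn_η.inv₀ fun t ht => (hP.η_pos t ht).ne'

theorem continuousOn_dη : ContinuousOn P.dη (Icc 0 P.T) :=
  hP.η_contDiff.continuousOn_derivWithin (uniqueDiffOn_Icc hP.T_pos) le_rfl

theorem continuousOn_dκ : ContinuousOn P.dκ (Icc 0 P.T) :=
  hP.κ_contDiff.continuousOn_derivWithin (uniqueDiffOn_Icc hP.T_pos) le_rfl

theorem hasACDeriv_η : HasACDeriv P.η P.dη 0 P.T :=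
  HasACDeriv.of_contDiffOn hP.T_pos hP.η_contDiff

theorem hasACDeriv_κ : HasACDeriv P.κ P.dκ 0 P.T :=
  HasACDeriv.of_contDiffOn hP.T_pos hP.κ_contDiff

theorem hasACDeriv_G : HasACDeriv P.G (fun t => P.G t * (P.δ * P.κ t / P.η t)) 0 P.T := by
  have hc : ContinuousOn (fun t => P.δ * P.κ t / P.η t) (uIcc 0 P.T) := by
    rw [hP.uIcc_eq]
    exact (continuousOn_const.mul hP.continuousOn_κ).div hP.continuousOn_η
      fun t ht => (hP.η_pos t ht).ne'
  exact (HasACDeriv.integral hc.intervalIntegrable left_mem_uIcc 0).exp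

theorem continuousOn_G : ContinuousOn P.G (Icc 0 P.T) :=
  hP.uIcc_eq ▸ hP.hasACDeriv_G.continuousOn

theorem β_pos : ∀ t ∈ Icc 0 P.T, 0 < P.β t := fun t ht =>
  one_div_pos.2 (mul_pos (hP.η_pos t ht) (G_pos t))

theorem continuousOn_β : ContinuousOn P.β (Icc 0 P.T) :=
  continuousOn_const.div (hP.continuousOn_η.mul hP.continuousOn_G)
    fun t ht => (mul_pos (hP.η_pos t ht) (G_pos t)).ne'

theorem exists_isFundamental : ∃ h p u w, IsFundamental P.β P.γ P.T h p u w := by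
  refine _root_.exists_isFundamental hP.T_pos.le hP.continuousOn_β hP.β_pos
    (hP.lam_memLp.mul_top hP.continuousOn_G.memLp_top_Icc) ?_
  filter_upwards [(ae_restrict_iff' measurableSet_Icc).1 hP.lam_nonneg] with t ht hts
  exact mul_nonneg (ht hts) (G_pos t).le

/-- The usual linearization, `A = w / (u G)`; the pole at `T` comes from `u T = 0` and `w T = 1`. -/
theorem exists_isRiccatiSolution : ∃ A, P.IsRiccatiSolution A := by
  obtain ⟨h, p, u, w, H⟩ := hP.exists_isFundamental
  have hT := hP.T_pos
  have hI := hP.uIcc_eq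
  have hu : ContinuousOn u (Icc 0 P.T) := hI ▸ H.bwd.left.continuousOn
  have hw : ContinuousOn w (Icc 0 P.T) := hI ▸ H.bwd.right.continuousOn
  have hne : ∀ t ∈ Ico 0 P.T, u t * P.G t ≠ 0 := fun t ht =>
    (mul_pos (H.u_pos t ht) (G_pos t)).ne'
  refine ⟨fun t => w t / (u t * P.G t), ?_, ?_, ?_⟩
  · exact (hw.mono Ico_subset_Icc_self).div
      ((hu.mul hP.continuousOn_G).mono Ico_subset_Icc_self) hne
  · intro s t hs hst ht
    have ht0 : 0 ≤ t := hs.trans hst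
    have hsub : uIcc 0 t ⊆ uIcc 0 P.T := by
      rw [uIcc_of_le ht0, hI]
      exact Icc_subset_Icc_right ht.le
    have hmem : ∀ x ∈ uIcc 0 t, x ∈ Ico 0 P.T := fun x hx => by
      rw [uIcc_of_le ht0] at hx
      exact ⟨hx.1, hx.2.trans_lt ht⟩
    have hd := ((H.bwd.right.mono hsub).div
      ((H.bwd.left.mul hP.hasACDeriv_G).mono hsub) fun x hx => hne x (hmem x hx)).congr_deriv_on
      (G' := fun r => (w r / (u r * P.G r)) ^ 2 / P.η r
        - P.δ * (P.κ r / P.η r) * (w r / (u r * P.G r)) - P.lam r) fun x hx => by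
          have h1 := (H.u_pos x (hmem x hx)).ne'
          have h2 := (G_pos (P := P) x).ne'
          have h3 := (hP.η_pos x (Ico_subset_Icc_self (hmem x hx))).ne'
          simp only [β, γ]
          field_simp
          ring
    rw [hd.integral_eq_sub_of_mem (by rw [uIcc_of_le ht0]; exact ⟨hs, hst⟩) right_mem_uIcc]
    ring
  · have hTm : P.T ∈ Icc 0 P.T := right_mem_Icc.2 hT.le
    have hle : 𝓝[<] P.T ≤ 𝓝[Icc 0 P.T] P.T := by
      rw [← nhdsWithin_Ico_eq_nhdsLT hT]
      exact nhdsWithin_mono _ Ico_subset_Icc_self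
    have h1 : Tendsto (fun t => w t / P.G t) (𝓝[<] P.T) (𝓝 (w P.T / P.G P.T)) :=
      ((hw.div hP.continuousOn_G fun t _ => (G_pos t).ne') P.T hTm).mono_left hle
    have h2 : Tendsto (fun t => (u t)⁻¹) (𝓝[<] P.T) atTop := by
      refine tendsto_inv_nhdsGT_zero.comp (tendsto_nhdsWithin_iff.2 ⟨?_, ?_⟩)
      · have := (hu P.T hTm).tendsto.mono_left hle
        rwa [H.u_T] at this
      · filter_upwards [Ico_mem_nhdsLT hT] with t ht
        exact H.u_pos t ht
    refine (h1.pos_mul_atTop (div_pos (H.w_pos P.T hTm) (G_pos _)) h2).congr fun t => ?_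
    rw [div_eq_mul_inv, div_eq_mul_inv, mul_inv]
    ring

theorem isRiccatiSolution_A : P.IsRiccatiSolution P.A :=
  Classical.epsilon_spec hP.exists_isRiccatiSolution

/-- No uniqueness for the Riccati equation is needed. For any solution `A`, with `v = exp(-∫ A/η)`,
the pair `(v, A v G)` solves the negated system, and its pairing with `(h, p)` keeps its initial
value `1`. Hence `(h / v)' = β / v²`, whose integral is the defining formula. -/
theorem h_eq {h p u w : ℝ → ℝ} (H : IsFundamental P.β P.γ P.T h p u w) :
    ∀ t ∈ Ico 0 P.T, P.h t = h t := by
  intro t ht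
  have hA := hP.isRiccatiSolution_A
  have hI : uIcc 0 t = Icc 0 t := uIcc_of_le ht.1
  have hsubI : Icc 0 t ⊆ Icc 0 P.T := Icc_subset_Icc_right ht.2.le
  have hsub : uIcc 0 t ⊆ uIcc 0 P.T := by rwa [hI, hP.uIcc_eq]
  have hAc : ContinuousOn P.A (Icc 0 t) :=
    hA.continuousOn.mono fun x hx => ⟨hx.1, hx.2.trans_lt ht.2⟩
  have hηc := hP.continuousOn_η.mono hsubI
  have hκc := hP.continuousOn_κ.mono hsubI
  have hηne : ∀ x ∈ Icc 0 t, P.η x ≠ 0 := fun x hx => (hP.η_pos x (hsubI hx)).ne'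
  have hlam : IntervalIntegrable P.lam volume 0 t :=
    (hP.lam_memLp.intervalIntegrable_of_top hP.T_pos.le).mono_set hsub
  have hAη : IntervalIntegrable (fun r => P.A r / P.η r) volume 0 t :=
    ContinuousOn.intervalIntegrable (by rw [hI]; exact hAc.div hηc hηne)
  have hκη : IntervalIntegrable (fun r => P.δ * P.κ r / P.η r) volume 0 t :=
    ContinuousOn.intervalIntegrable
      (by rw [hI]; exact (continuousOn_const.mul hκc).div hηc hηne)
  have hAd : HasACDeriv P.A
      (fun r => P.A r ^ 2 / P.η r - P.δ * (P.κ r / P.η r) * P.A r - P.lam r) 0 t := by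
    refine HasACDeriv.of_integral (IntervalIntegrable.sub
      (ContinuousOn.intervalIntegrable ?_) hlam) left_mem_uIcc (k := P.A 0) fun s hs => ?_
    · rw [hI]
      exact ((hAc.pow 2).div hηc hηne).sub
        ((continuousOn_const.mul (hκc.div hηc hηne)).mul hAc)
    · rw [hI] at hs
      exact hA.eq 0 s le_rfl hs.1 (hs.2.trans_lt ht.2)
  set v : ℝ → ℝ := fun r => Real.exp (-(0 + ∫ s in (0 : ℝ)..r, P.A s / P.η s)) with hv
  have hvd : HasACDeriv v (fun r => v r * -(P.A r / P.η r)) 0 t :=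
    (HasACDeriv.integral hAη left_mem_uIcc 0).neg.exp
  have hvpos : ∀ r, 0 < v r := fun r => Real.exp_pos _
  have hsol : IsLinSol (fun t => -P.β t) (fun t => -P.γ t) t v
      (fun r => P.A r * v r * P.G r) := by
    refine ⟨hvd.congr_deriv_on fun x hx => ?_,
      ((hAd.mul hvd).mul (hP.hasACDeriv_G.mono hsub)).congr_deriv_on fun x hx => ?_⟩
    · have h1 := hηne x (hI ▸ hx)
      have h2 := (G_pos (P := P) x).ne'
      simp only [β]
      field_simp
    · have h1 := hηne x (hI ▸ hx)
      simp only [γ]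
      field_simp
      ring
  have hfwd : IsLinSol P.β P.γ t h p := ⟨H.fwd.left.mono hsub, H.fwd.right.mono hsub⟩
  have hdet : ∀ x ∈ uIcc 0 t, v x * p x + P.A x * v x * P.G x * h x = 1 := by
    intro x hx
    rw [hfwd.pairing hsol hx left_mem_uIcc, H.h_zero, H.p_zero]
    simp [hv]
  have hq := (hfwd.left.div hvd fun x _ => (hvpos x).ne').congr_deriv_on
    (G' := fun x => P.β x / v x ^ 2) fun x hx => by
      have h1 := hηne x (hI ▸ hx)
      have h2 := (G_pos (P := P) x).ne'
      have h3 := (hvpos x).ne'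
      have h4 := hdet x hx
      have h5 : P.A x / P.η x = P.β x * (P.A x * P.G x) := by
        simp only [β]
        field_simp
      simp only [h5]
      congr 1
      linear_combination P.β x * h4
  have hint := hq.integral_eq_sub
  rw [H.h_zero, zero_div, sub_zero] at hint
  have hfac : ∀ s ∈ uIcc 0 t, 1 / P.η s *
      Real.exp (∫ r in (0 : ℝ)..s, (2 * P.A r - P.δ * P.κ r) / P.η r) = P.β s / v s ^ 2 := by
    intro s hs
    have hsub' : uIcc 0 s ⊆ uIcc 0 t := uIcc_subset_uIcc left_mem_uIcc hs
    have : ∫ r in (0 : ℝ)..s, (2 * P.A r - P.δ * P.κ r) / P.η r =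
        2 * (∫ r in (0 : ℝ)..s, P.A r / P.η r) - ∫ r in (0 : ℝ)..s, P.δ * P.κ r / P.η r := by
      rw [← intervalIntegral.integral_const_mul, ← intervalIntegral.integral_sub
        ((hAη.mono_set hsub').const_mul 2) (hκη.mono_set hsub')]
      exact intervalIntegral.integral_congr fun r _ => by ring
    rw [this, Real.exp_sub, two_mul, Real.exp_add]
    simp only [β, hv, G, zero_add, Real.exp_neg]
    have h1 := hηne s (hI ▸ hs)
    field_simp
  rw [Params.h, intervalIntegral.integral_congr hfac, hint]
  have : Real.exp (-∫ r in (0 : ℝ)..t, P.A r / P.η r) = v t := by simp [hv]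
  rw [this, mul_div_cancel₀ _ (hvpos t).ne']

theorem α_eq {h p u w : ℝ → ℝ} (H : IsFundamental P.β P.γ P.T h p u w) : P.α = (h P.T)⁻¹ := by
  rw [α]
  congr 1
  refine Tendsto.limUnder_eq ?_
  have hle : 𝓝[<] P.T ≤ 𝓝[Icc 0 P.T] P.T := by
    rw [← nhdsWithin_Ico_eq_nhdsLT hP.T_pos]
    exact nhdsWithin_mono _ Ico_subset_Icc_self
  have hc : ContinuousOn h (Icc 0 P.T) := hP.uIcc_eq ▸ H.fwd.left.continuousOn
  refine ((hc P.T (right_mem_Icc.2 hP.T_pos.le)).tendsto.mono_left hle).congr' ?_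
  filter_upwards [Ico_mem_nhdsLT hP.T_pos] with t ht
  exact (hP.h_eq H t ht).symm

end Admissible
end Params
end Liquidation

/-! ### The forward-backward system of a single player -/

namespace Liquidation

namespace Params

variable {P : Params} {μ : ℝ → ℝ} {x : ℝ}

namespace Admissible

variable (hP : P.Admissible) {h p u w : ℝ → ℝ} (H : IsFundamental P.β P.γ P.T h p u w)
include hP

theorem mem_uIcc_iff {t : ℝ} : t ∈ uIcc 0 P.T ↔ t ∈ Icc 0 P.T := by rw [hP.uIcc_eq]

theorem zero_mem : (0 : ℝ) ∈ Icc 0 P.T := left_mem_Icc.2 hP.T_pos.le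

theorem T_mem : P.T ∈ Icc 0 P.T := right_mem_Icc.2 hP.T_pos.le

theorem intervalIntegrable_κ_mul (hμ : IntervalIntegrable μ volume 0 P.T) :
    IntervalIntegrable (fun t => P.κ t * μ t) volume 0 P.T :=
  hμ.continuousOn_mul (hP.uIcc_eq ▸ hP.continuousOn_κ)

theorem intervalIntegrable_mul_κ {g : ℝ → ℝ} (hg : ContinuousOn g (uIcc 0 P.T))
    (hμ : IntervalIntegrable μ volume 0 P.T) :
    IntervalIntegrable (fun t => g t * (P.κ t * μ t)) volume 0 P.T :=
  (hP.intervalIntegrable_κ_mul hμ).continuousOn_mul hg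

include H in
theorem hasACDeriv_f (hμ : IntervalIntegrable μ volume 0 P.T) :
    HasACDeriv (P.f μ) (fun t => h t * (P.κ t * μ t)) 0 P.T := by
  refine HasACDeriv.of_integral (hP.intervalIntegrable_mul_κ H.fwd.left.continuousOn hμ)
    left_mem_uIcc (k := 0) fun t ht => ?_
  rw [zero_add, f]
  refine intervalIntegral.integral_congr_ae ?_
  -- `h_eq` stops short of `T`, which is a null set.
  filter_upwards [ae_mem_uIcc_imp_mem_uIoo 0 P.T] with s hs hst
  have hsT := hs (uIcc_subset_uIcc left_mem_uIcc ht (uIoc_subset_uIcc hst))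
  rw [uIoo_of_le hP.T_pos.le] at hsT
  rw [hP.h_eq H s ⟨hsT.1.le, hsT.2⟩]
  ring

theorem continuousOn_f (hμ : IntervalIntegrable μ volume 0 P.T) :
    ContinuousOn (P.f μ) (Icc 0 P.T) := by
  obtain ⟨h, p, u, w, H⟩ := hP.exists_isFundamental
  exact hP.uIcc_eq ▸ (hP.hasACDeriv_f H hμ).continuousOn

omit hP in
theorem f_zero : P.f μ 0 = 0 := by simp [f]

theorem τ_mem : P.τ μ x ∈ Icc 0 P.T := by
  unfold τ
  split_ifs with hx
  · obtain ⟨t, ht, hft⟩ := hx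
    have hne : {t | t ∈ Icc 0 P.T ∧ P.f μ t = x}.Nonempty := ⟨t, ht, hft⟩
    have hle : sInf {t | t ∈ Icc 0 P.T ∧ P.f μ t = x} ≤ t :=
      csInf_le ⟨0, fun s hs => hs.1.1⟩ ⟨ht, hft⟩
    exact ⟨le_csInf hne fun s hs => hs.1.1, hle.trans ht.2⟩
  · exact hP.T_mem

theorem f_τ (hμ : IntervalIntegrable μ volume 0 P.T) (hlt : P.τ μ x < P.T) :
    P.f μ (P.τ μ x) = x := by
  unfold τ at hlt ⊢
  split_ifs at hlt ⊢ with hx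
  · obtain ⟨t, ht, hft⟩ := hx
    have hcl : IsClosed {t | t ∈ Icc 0 P.T ∧ P.f μ t = x} :=
      (hP.continuousOn_f hμ).preimage_isClosed_of_isClosed isClosed_Icc (isClosed_singleton (x := x))
    exact (hcl.csInf_mem ⟨t, ht, hft⟩ ⟨0, fun s hs => hs.1.1⟩).2
  · exact absurd hlt (lt_irrefl _)

omit hP in
theorem τ_le_of_f_eq {t : ℝ} (ht : t ∈ Icc 0 P.T) (hft : P.f μ t = x) : P.τ μ x ≤ t := by
  unfold τ
  rw [if_pos ⟨t, ht, hft⟩]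
  exact csInf_le ⟨0, fun s hs => hs.1.1⟩ ⟨ht, hft⟩

theorem τ_lt_iff (hμ : IntervalIntegrable μ volume 0 P.T) {s : ℝ} (hs : s ≤ P.T) :
    P.τ μ x < s ↔ ∃ r ∈ Ico 0 s, P.f μ r = x := by
  constructor
  · intro hlt
    exact ⟨P.τ μ x, ⟨hP.τ_mem.1, hlt⟩, hP.f_τ hμ (hlt.trans_le hs)⟩
  · rintro ⟨r, hr, hrx⟩
    exact (τ_le_of_f_eq ⟨hr.1, hr.2.le.trans hs⟩ hrx).trans_lt hr.2

/-- For `s ≤ T`, the set `{τ < s}` is the image of `[0, s)` under the continuous `f_μ`, hence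
order-connected and Borel. -/
theorem measurable_τ (hμ : IntervalIntegrable μ volume 0 P.T) : Measurable (P.τ μ) := by
  refine measurable_of_Iio fun s => ?_
  rcases lt_or_ge P.T s with hs | hs
  · have : P.τ μ ⁻¹' Iio s = univ := eq_univ_of_forall fun x => hP.τ_mem.2.trans_lt hs
    rw [this]
    exact MeasurableSet.univ
  · have : P.τ μ ⁻¹' Iio s = P.f μ '' Ico 0 s := by
      ext x
      exact hP.τ_lt_iff hμ hs
    rw [this]
    refine (isPreconnected_Ico.image _ ((hP.continuousOn_f hμ).mono ?_)).ordConnected.measurableSet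
    exact fun r hr => ⟨hr.1, hr.2.le.trans hs⟩

/-- Variation of constants: if `a' = -u q` and `b' = -h q`, then `X = G (u b - h a) / h_T` and
`Y = (p a + w b) / h_T` satisfy `X' = -(Y - δ κ X) / η` and `Y' = -(λ X + q)`. -/
theorem variation_of_constants (H : IsFundamental P.β P.γ P.T h p u w) {a b q : ℝ → ℝ}
    (ha : HasACDeriv a (fun t => -(u t * q t)) 0 P.T)
    (hb : HasACDeriv b (fun t => -(h t * q t)) 0 P.T) :
    HasACDeriv (fun t => P.G t * ((h P.T)⁻¹ * (u t * b t - h t * a t)))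
      (fun t => -(((h P.T)⁻¹ * (p t * a t + w t * b t)
        - P.δ * P.κ t * (P.G t * ((h P.T)⁻¹ * (u t * b t - h t * a t)))) / P.η t)) 0 P.T ∧
    HasACDeriv (fun t => (h P.T)⁻¹ * (p t * a t + w t * b t))
      (fun t => -(P.lam t * (P.G t * ((h P.T)⁻¹ * (u t * b t - h t * a t))) + q t)) 0 P.T := by
  have hT := (H.h_pos P.T ⟨hP.T_pos, le_rfl⟩).ne'
  constructor
  · refine (hP.hasACDeriv_G.mul (((H.bwd.left.mul hb).sub
      (H.fwd.left.mul ha)).const_mul _)).congr_deriv_on fun t ht => ?_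
    have h1 := (hP.η_pos t (hP.mem_uIcc_iff.1 ht)).ne'
    have h2 := (G_pos (P := P) t).ne'
    simp only [β]
    field_simp
    ring
  · refine (((H.fwd.right.mul ha).add (H.bwd.right.mul hb)).const_mul _).congr_deriv_on
      fun t ht => ?_
    have h1 := H.det ht
    simp only [γ]
    field_simp
    linear_combination (-q t) * h1

end Admissible

/-- `∫₀ᵗ u κ μ`. -/
def potential (P : Params) (u μ : ℝ → ℝ) (t : ℝ) : ℝ := ∫ s in (0 : ℝ)..t, u s * (P.κ s * μ s)

/-- The state process before liquidation. -/
def stateX (P : Params) (h u μ : ℝ → ℝ) (x t : ℝ) : ℝ :=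
  P.G t * ((h P.T)⁻¹ * (u t * (x - P.f μ t)
    - h t * (P.potential u μ (P.τ μ x) - P.potential u μ t)))

/-- The adjoint process before liquidation. -/
def stateY (P : Params) (h p u w μ : ℝ → ℝ) (x t : ℝ) : ℝ :=
  (h P.T)⁻¹ * (p t * (P.potential u μ (P.τ μ x) - P.potential u μ t) + w t * (x - P.f μ t))

theorem integral_indicator_Iic {g : ℝ → ℝ} {s t σ : ℝ} (hst : s ≤ t) (hs : s ≤ σ) :
    ∫ r in s..t, (Iic σ).indicator g r = ∫ r in s..min t σ, g r := by
  rw [intervalIntegral.integral_of_le hst, intervalIntegral.integral_of_le (le_min hst hs),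
    setIntegral_indicator measurableSet_Iic, Ioc_inter_Iic]

namespace Admissible

variable (hP : P.Admissible) {h p u w : ℝ → ℝ} (H : IsFundamental P.β P.γ P.T h p u w)
include hP H

theorem hasACDeriv_potential (hμ : IntervalIntegrable μ volume 0 P.T) :
    HasACDeriv (P.potential u μ) (fun t => u t * (P.κ t * μ t)) 0 P.T :=
  HasACDeriv.of_integral (hP.intervalIntegrable_mul_κ H.bwd.left.continuousOn hμ)
    left_mem_uIcc (k := 0) fun _ _ => (zero_add _).symm

theorem hasACDeriv_state (hμ : IntervalIntegrable μ volume 0 P.T) :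
    HasACDeriv (P.stateX h u μ x)
      (fun t => -((P.stateY h p u w μ x t - P.δ * P.κ t * P.stateX h u μ x t) / P.η t)) 0 P.T ∧
    HasACDeriv (P.stateY h p u w μ x)
      (fun t => -(P.lam t * P.stateX h u μ x t + P.κ t * μ t)) 0 P.T := by
  refine hP.variation_of_constants H
    (a := fun t => P.potential u μ (P.τ μ x) - P.potential u μ t)
    (b := fun t => x - P.f μ t) ?_ ?_
  · simpa using (HasACDeriv.const _).sub (hP.hasACDeriv_potential H hμ)
  · simpa using (HasACDeriv.const _).sub (hP.hasACDeriv_f H hμ)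

/-- An early exit has `f_μ(τ) = x`; otherwise `τ = T` and `u T = 0`. -/
theorem stateX_τ (hμ : IntervalIntegrable μ volume 0 P.T) :
    P.stateX h u μ x (P.τ μ x) = 0 := by
  rcases (hP.τ_mem (μ := μ) (x := x)).2.lt_or_eq with hlt | heq
  · simp [stateX, hP.f_τ hμ hlt]
  · simp [stateX, heq, H.u_T]

omit H in
theorem stateY_τ (hμ : IntervalIntegrable μ volume 0 P.T) (hlt : P.τ μ x < P.T) :
    P.stateY h p u w μ x (P.τ μ x) = 0 := by
  simp [stateY, hP.f_τ hμ hlt]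

theorem stateX_zero : P.stateX h u μ x 0 = x := by
  have := (H.h_pos P.T ⟨hP.T_pos, le_rfl⟩).ne'
  simp only [stateX, G_zero, f_zero, H.h_zero, H.u_zero]
  field_simp
  ring

theorem exists_isFBSolution (hμ : IntervalIntegrable μ volume 0 P.T) (x : ℝ) :
    P.IsFBSolution μ x (fun t => P.stateX h u μ x (min t (P.τ μ x)))
      (fun t => P.stateY h p u w μ x (min t (P.τ μ x))) := by
  obtain ⟨hX, hY⟩ := hP.hasACDeriv_state H (x := x) hμ
  have hτ : P.τ μ x ∈ Icc 0 P.T := hP.τ_mem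
  have hmin : ∀ t ∈ Icc 0 P.T, min t (P.τ μ x) ∈ uIcc 0 P.T := fun t ht =>
    hP.mem_uIcc_iff.2 ⟨le_min ht.1 hτ.1, (min_le_left _ _).trans ht.2⟩
  have hτm : P.τ μ x ∈ uIcc 0 P.T := hP.mem_uIcc_iff.2 hτ
  have hminc : ContinuousOn (fun t : ℝ => min t (P.τ μ x)) (Icc 0 P.T) :=
    (continuous_id.min continuous_const).continuousOn
  refine ⟨hX.continuousOn.comp hminc hmin, hY.continuousOn.comp hminc hmin, ?_, ?_, ?_, ?_⟩
  · intro t ht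
    rw [integral_indicator_Iic ht.1 hτ.1]
    have h1 := hX.neg.integral_eq_sub_of_mem left_mem_uIcc (hmin t ht)
    rw [hP.stateX_zero H] at h1
    simp only [neg_neg] at h1
    have h2 : ∀ s ∈ uIcc 0 (min t (P.τ μ x)), min s (P.τ μ x) = s := fun s hs => by
      rw [uIcc_of_le (le_min ht.1 hτ.1)] at hs
      exact min_eq_left (hs.2.trans (min_le_right _ _))
    rw [intervalIntegral.integral_congr (g := fun s =>
      (P.stateY h p u w μ x s - P.δ * P.κ s * P.stateX h u μ x s) / P.η s)
      fun s hs => by simp only [h2 s hs], h1]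
    ring
  · intro t ht
    rw [min_eq_right hτ.2]
    rcases le_or_gt t (P.τ μ x) with hle | hgt
    · rw [integral_indicator_Iic ht.2 hle, min_eq_right hτ.2, min_eq_left hle]
      have h1 := hY.neg.integral_eq_sub_of_mem (hP.mem_uIcc_iff.2 ht) hτm
      simp only [neg_neg] at h1
      rw [intervalIntegral.integral_congr (g := fun s =>
        P.lam s * P.stateX h u μ x s + P.κ s * μ s) fun s hs => ?_, h1]
      · ring
      · rw [uIcc_of_le hle] at hs
        simp only [min_eq_left hs.2]
    · rw [min_eq_right hgt.le]
      rw [intervalIntegral.integral_of_le ht.2, setIntegral_indicator measurableSet_Iic,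
        Ioc_inter_Iic, Ioc_eq_empty (by simp [hgt.le])]
      simp
  · rw [min_eq_right hτ.2, hP.stateX_τ H hμ]
  · intro hlt
    rw [min_eq_right hτ.2, hP.stateY_τ hμ hlt]

/-- Both components are frozen after `τ`. On `[0, τ]` two first integrals, one evaluated at `0` and
one at `τ`, determine `X` and `Y` algebraically. -/
theorem isFBSolution_unique (hμ : IntervalIntegrable μ volume 0 P.T) {X Y : ℝ → ℝ}
    (hXY : P.IsFBSolution μ x X Y) {t : ℝ} (ht : t ∈ Icc 0 P.T) :
    X t = P.stateX h u μ x (min t (P.τ μ x)) ∧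
      Y t = P.stateY h p u w μ x (min t (P.τ μ x)) := by
  have hI := hP.uIcc_eq
  set τ := P.τ μ x with hτdef
  have hτ : τ ∈ Icc 0 P.T := hP.τ_mem
  have hτm : τ ∈ uIcc 0 P.T := hI ▸ hτ
  have hηne : ∀ t ∈ Icc 0 P.T, P.η t ≠ 0 := fun t ht => (hP.η_pos t ht).ne'
  have hgX : IntervalIntegrable (fun s => (Y s - P.δ * P.κ s * X s) / P.η s) volume 0 P.T := by
    refine ContinuousOn.intervalIntegrable ?_
    rw [hI]
    exact (hXY.continuousOn_Y.sub ((continuousOn_const.mul hP.continuousOn_κ).mul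
      hXY.continuousOn_X)).div hP.continuousOn_η hηne
  have hgY : IntervalIntegrable (fun s => P.lam s * X s + P.κ s * μ s) volume 0 P.T :=
    ((hP.lam_memLp.intervalIntegrable_of_top hP.T_pos.le).mul_continuousOn
      (hI ▸ hXY.continuousOn_X)).add (hP.intervalIntegrable_κ_mul hμ)
  have hXconst : ∀ t ∈ Icc 0 P.T, X t = X (min t τ) := by
    intro t ht
    rw [hXY.eq_X t ht, hXY.eq_X (min t τ) ⟨le_min ht.1 hτ.1, (min_le_left _ _).trans ht.2⟩,
      integral_indicator_Iic ht.1 hτ.1, integral_indicator_Iic (le_min ht.1 hτ.1) hτ.1]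
    simp
  have hYconst : ∀ t ∈ Icc 0 P.T, Y t = Y (min t τ) := by
    intro t ht
    rcases le_or_gt t τ with hle | hgt
    · rw [min_eq_left hle]
    · have aux : ∀ s ∈ Icc 0 P.T, τ ≤ s → Y s = Y P.T := by
        intro s hs hτs
        rw [hXY.eq_Y s hs, intervalIntegral.integral_of_le hs.2,
          setIntegral_indicator measurableSet_Iic, Ioc_inter_Iic, Ioc_eq_empty (by simp [hτs, ← hτdef])]
        simp
      rw [min_eq_right hgt.le, aux t ht hgt.le, aux τ hτ le_rfl]
  have hXτ : X τ = 0 := by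
    rw [← hXY.X_T, hXconst P.T hP.T_mem, min_eq_right hτ.2]
  -- `Y τ` itself is free when `τ = T`, but it enters only through this product, and there `u`
  -- vanishes.
  have huY : u τ * Y τ = 0 := by
    rcases hτ.2.lt_or_eq with hlt | heq
    · have := hYconst P.T hP.T_mem
      rw [min_eq_right hτ.2, hXY.Y_T hlt] at this
      rw [← this, mul_zero]
    · rw [heq, H.u_T, zero_mul]
  have hsub : uIcc 0 τ ⊆ uIcc 0 P.T := uIcc_subset_uIcc left_mem_uIcc hτm
  have hX : HasACDeriv X (fun s => -((Y s - P.δ * P.κ s * X s) / P.η s)) 0 τ := by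
    refine HasACDeriv.of_integral (hgX.neg.mono_set hsub) left_mem_uIcc (k := x) fun t ht => ?_
    rw [uIcc_of_le hτ.1] at ht
    rw [hXY.eq_X t ⟨ht.1, ht.2.trans hτ.2⟩, integral_indicator_Iic ht.1 hτ.1, min_eq_left ht.2,
      intervalIntegral.integral_neg, sub_eq_add_neg]
  have hY : HasACDeriv Y (fun s => -(P.lam s * X s + P.κ s * μ s)) 0 τ := by
    refine HasACDeriv.of_integral (hgY.neg.mono_set hsub) right_mem_uIcc (k := Y P.T)
      fun t ht => ?_
    rw [uIcc_of_le hτ.1] at ht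
    rw [hXY.eq_Y t ⟨ht.1, ht.2.trans hτ.2⟩, integral_indicator_Iic (ht.2.trans hτ.2) ht.2,
      min_eq_right hτ.2, intervalIntegral.integral_neg, intervalIntegral.integral_symm τ t]
  have hG := hP.hasACDeriv_G.mono hsub
  have hXG := hX.div hG fun s _ => (G_pos s).ne'
  -- The conserved quantities are `h Y + p X/G + f_μ` and `u Y - w X/G + ∫ u κ μ`.
  have c1 := (((H.fwd.left.mono hsub).mul hY).add ((H.fwd.right.mono hsub).mul hXG)).add
    ((hP.hasACDeriv_f H hμ).mono hsub)
  have c2 := (((H.bwd.left.mono hsub).mul hY).sub ((H.bwd.right.mono hsub).mul hXG)).add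
    ((hP.hasACDeriv_potential H hμ).mono hsub)
  have e1 := fun s (hs : s ∈ uIcc 0 τ) => (c1.congr_deriv_on (G' := fun _ => 0) fun r hr => by
    have h1 := hηne r (hI ▸ hsub hr)
    have h2 := (G_pos (P := P) r).ne'
    simp only [β, γ]
    field_simp
    ring).eq_of_deriv_zero hs left_mem_uIcc
  have e2 := fun s (hs : s ∈ uIcc 0 τ) => (c2.congr_deriv_on (G' := fun _ => 0) fun r hr => by
    have h1 := hηne r (hI ▸ hsub hr)
    have h2 := (G_pos (P := P) r).ne'
    simp only [β, γ]
    field_simp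
    ring).eq_of_deriv_zero hs right_mem_uIcc
  have hX0 : X 0 = x := by
    rw [hXY.eq_X 0 hP.zero_mem]
    simp
  have key : ∀ s ∈ uIcc 0 τ, X s = P.stateX h u μ x s ∧ Y s = P.stateY h p u w μ x s := by
    intro s hs
    have d1 := e1 s hs
    have d2 := e2 s hs
    rw [H.h_zero, H.p_zero, hX0, G_zero, f_zero] at d1
    rw [huY, hXτ] at d2
    have det := H.det (hsub hs)
    have hT := (H.h_pos P.T ⟨hP.T_pos, le_rfl⟩).ne'
    have h2 := (G_pos (P := P) s).ne'
    have hXs : X s = P.G s * (X s / P.G s) := by field_simp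
    simp only [stateX, stateY]
    constructor
    · rw [hXs]
      congr 1
      rw [eq_inv_mul_iff_mul_eq₀ hT]
      linear_combination u s * d1 - h s * d2 - X s / P.G s * det
    · rw [eq_inv_mul_iff_mul_eq₀ hT]
      linear_combination p s * d2 + w s * d1 - Y s * det
  have hmem : min t τ ∈ uIcc 0 τ := by
    rw [uIcc_of_le hτ.1]
    exact ⟨le_min ht.1 hτ.1, min_le_right _ _⟩
  rw [hXconst t ht, hYconst t ht]
  exact key _ hmem

theorem ξ_eq (hμ : IntervalIntegrable μ volume 0 P.T) {t : ℝ} (ht : t ∈ Icc 0 P.T) (x : ℝ) :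
    P.ξ μ x t = (P.stateY h p u w μ x (min t (P.τ μ x))
      - P.δ * P.κ t * P.stateX h u μ x (min t (P.τ μ x))) / P.η t := by
  have hspec : P.IsFBSolution μ x (P.XY μ x).1 (P.XY μ x).2 :=
    Classical.epsilon_spec (p := fun p : (ℝ → ℝ) × (ℝ → ℝ) => P.IsFBSolution μ x p.1 p.2)
      ⟨(_, _), hP.exists_isFBSolution H hμ x⟩
  obtain ⟨hX, hY⟩ := hP.isFBSolution_unique H hμ hspec ht
  rw [ξ, hX, hY]

end Admissible
end Params
end Liquidation

/-! ### Averaging over the initial positions -/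

theorem integrable_and_integral_indicator_Iic {ν : Measure ℝ} [IsFiniteMeasure ν] {σ g : ℝ → ℝ}
    {a b : ℝ} (hσ : Measurable σ) (hab : a ≤ b) (hg : IntervalIntegrable g volume a b) :
    Integrable (fun x => ∫ s in a..b, (Iic (σ x)).indicator g s) ν ∧
      ∫ x, (∫ s in a..b, (Iic (σ x)).indicator g s) ∂ν =
        ∫ s in a..b, ν.real {x | s ≤ σ x} * g s := by
  have hK : Integrable (Function.uncurry fun x s => (Iic (σ x)).indicator g s)
      (ν.prod (volume.restrict (Ioc a b))) := by
    have h1 : Integrable (fun q : ℝ × ℝ => g q.2) (ν.prod (volume.restrict (Ioc a b))) :=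
      ((intervalIntegrable_iff_integrableOn_Ioc_of_le hab).1 hg).comp_snd ν
    have hs : MeasurableSet {q : ℝ × ℝ | q.2 ≤ σ q.1} :=
      measurableSet_le measurable_snd (hσ.comp measurable_fst)
    exact (h1.indicator hs).congr (ae_of_all _ fun q => rfl)
  simp only [intervalIntegral.integral_of_le hab]
  refine ⟨hK.integral_prod_left, ?_⟩
  rw [integral_integral_swap hK]
  congr 1
  ext s
  have : (fun x => (Iic (σ x)).indicator g s) = {x | s ≤ σ x}.indicator fun _ => g s := by
    ext x
    simp [indicator, mem_Iic]
  rw [this, integral_indicator_const _ (measurableSet_le measurable_const hσ), smul_eq_mul]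

namespace Liquidation

namespace Params

/-- The `ν₀`-proportion of players that have not left before time `s`. -/
def survival (P : Params) (ν₀ : Measure ℝ) (μ : ℝ → ℝ) (s : ℝ) : ℝ := ν₀.real {x | s ≤ P.τ μ x}

variable {P : Params} {μ : ℝ → ℝ} {ν₀ : Measure ℝ} [IsProbabilityMeasure ν₀]

theorem survival_antitone : Antitone (P.survival ν₀ μ) := fun _ _ hst =>
  measureReal_mono fun _ hx => hst.trans hx

theorem memLp_top_survival {s : Set ℝ} : MemLp (P.survival ν₀ μ) ⊤ (volume.restrict s) :=
  memLp_top_of_bound survival_antitone.measurable.aestronglyMeasurable 1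
    (ae_of_all _ fun _ => by
      rw [Real.norm_eq_abs, survival, abs_of_nonneg measureReal_nonneg]
      exact measureReal_le_one)

namespace Admissible

variable (hP : P.Admissible) {h p u w : ℝ → ℝ} (H : IsFundamental P.β P.γ P.T h p u w)
include hP

/-- A stopped primitive is the integral of its density cut off at `τ`, so Fubini replaces the
cut-off by the surviving mass. -/
theorem apply_min_τ (hμ : IntervalIntegrable μ volume 0 P.T) {g Φ : ℝ → ℝ}
    (hg : ContinuousOn g (uIcc 0 P.T))
    (hΦ : HasACDeriv Φ (fun s => g s * (P.κ s * μ s)) 0 P.T) (hΦ0 : Φ 0 = 0) {t : ℝ}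
    (ht : t ∈ Icc 0 P.T) :
    Integrable (fun x => Φ (min t (P.τ μ x))) ν₀ ∧
      ∫ x, Φ (min t (P.τ μ x)) ∂ν₀ =
        ∫ s in (0 : ℝ)..t, P.survival ν₀ μ s * (g s * (P.κ s * μ s)) := by
  have hgi := (hP.intervalIntegrable_mul_κ hg hμ).mono_set
    (uIcc_subset_uIcc left_mem_uIcc (hP.mem_uIcc_iff.2 ht))
  have h1 := integrable_and_integral_indicator_Iic (ν := ν₀) (hP.measurable_τ hμ) ht.1 hgi
  have h2 : ∀ x, ∫ s in (0 : ℝ)..t, (Iic (P.τ μ x)).indicator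
      (fun s => g s * (P.κ s * μ s)) s = Φ (min t (P.τ μ x)) := fun x => by
    have hτ := hP.τ_mem (μ := μ) (x := x)
    rw [integral_indicator_Iic ht.1 hτ.1, hΦ.integral_eq_sub_of_mem left_mem_uIcc
      (hP.mem_uIcc_iff.2 ⟨le_min ht.1 hτ.1, (min_le_left _ _).trans ht.2⟩), hΦ0, sub_zero]
  simp only [h2] at h1
  exact h1

theorem intervalIntegrable_survival (hμ : IntervalIntegrable μ volume 0 P.T) :
    IntervalIntegrable (fun s => P.survival ν₀ μ s * (P.κ s * μ s)) volume 0 P.T := by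
  rw [intervalIntegrable_iff]
  have h1 := intervalIntegrable_iff.1 (hP.intervalIntegrable_κ_mul hμ)
  refine Integrable.bdd_mul (c := 1) h1 survival_antitone.measurable.aestronglyMeasurable ?_
  refine ae_of_all _ fun _ => ?_
  rw [Real.norm_eq_abs, survival, abs_of_nonneg measureReal_nonneg]
  exact measureReal_le_one

/-- The coefficients `G, h, u, p, w` may be taken at `t` instead of the stopped time because past
`τ` both brackets vanish. This leaves only `x` and the stopped primitives to be averaged. -/
theorem state_min_τ (hμ : IntervalIntegrable μ volume 0 P.T) {t : ℝ} (ht : t ≤ P.T) (x : ℝ) :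
    P.stateX h u μ x (min t (P.τ μ x)) = P.G t * ((h P.T)⁻¹ *
        (u t * (x - P.f μ (min t (P.τ μ x))) - h t * (P.potential u μ (min P.T (P.τ μ x))
          - P.potential u μ (min t (P.τ μ x))))) ∧
      P.stateY h p u w μ x (min t (P.τ μ x)) = (h P.T)⁻¹ *
        (p t * (P.potential u μ (min P.T (P.τ μ x)) - P.potential u μ (min t (P.τ μ x)))
          + w t * (x - P.f μ (min t (P.τ μ x)))) := by
  rw [min_eq_right (hP.τ_mem (μ := μ) (x := x)).2]
  rcases le_or_gt t (P.τ μ x) with hle | hgt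
  · rw [min_eq_left hle]
    exact ⟨rfl, rfl⟩
  · rw [min_eq_right hgt.le]
    simp [stateX, stateY, hP.f_τ hμ (hgt.trans_le ht)]

include H in
/-- The mean state `X` and the mean rate `F(μ)` solve a linear system, driven by the mass of the
players that are still in the market. -/
theorem exists_aggregate (hν₀ : Integrable (fun x : ℝ => x) ν₀)
    (hμ : IntervalIntegrable μ volume 0 P.T) :
    ∃ X : ℝ → ℝ, HasACDeriv X (fun t => -P.F ν₀ μ t) 0 P.T ∧ X P.T = 0 ∧ X 0 = mean ν₀ ∧
      HasACDeriv (P.F ν₀ μ) (fun t => -((P.lam t + P.δ * P.dκ t) / P.η t * X t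
        + P.κ t / P.η t * P.survival ν₀ μ t * μ t
        + (P.dη t - P.δ * P.κ t) / P.η t * P.F ν₀ μ t)) 0 P.T ∧
      P.F ν₀ μ P.T = P.α / P.η P.T * (mean ν₀ - ∫ x, P.f μ (P.τ μ x) ∂ν₀) := by
  have hT := (H.h_pos P.T ⟨hP.T_pos, le_rfl⟩).ne'
  set q : ℝ → ℝ := fun s => P.survival ν₀ μ s * (P.κ s * μ s) with hq
  have hqi : IntervalIntegrable q volume 0 P.T := hP.intervalIntegrable_survival hμ
  have hint : ∀ {g : ℝ → ℝ}, ContinuousOn g (uIcc 0 P.T) →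
      HasACDeriv (fun t => ∫ s in (0 : ℝ)..t, P.survival ν₀ μ s * (g s * (P.κ s * μ s)))
        (fun s => g s * q s) 0 P.T := by
    intro g hg
    refine HasACDeriv.of_integral (hqi.continuousOn_mul hg) left_mem_uIcc (k := 0) fun t _ => ?_
    rw [zero_add]
    exact intervalIntegral.integral_congr fun s _ => by simp only [hq]; ring
  have hf := fun t (ht : t ∈ Icc 0 P.T) => hP.apply_min_τ (ν₀ := ν₀) hμ H.fwd.left.continuousOn
    (hP.hasACDeriv_f H hμ) f_zero ht
  have hI := fun t (ht : t ∈ Icc 0 P.T) => hP.apply_min_τ (ν₀ := ν₀) hμ H.bwd.left.continuousOn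
    (hP.hasACDeriv_potential H hμ) (by simp [potential]) ht
  set a : ℝ → ℝ := fun t =>
    (∫ s in (0 : ℝ)..P.T, P.survival ν₀ μ s * (u s * (P.κ s * μ s)))
      - ∫ s in (0 : ℝ)..t, P.survival ν₀ μ s * (u s * (P.κ s * μ s)) with ha
  set b : ℝ → ℝ := fun t =>
    mean ν₀ - ∫ s in (0 : ℝ)..t, P.survival ν₀ μ s * (h s * (P.κ s * μ s)) with hb
  have had : HasACDeriv a (fun t => -(u t * q t)) 0 P.T := by
    simpa using (HasACDeriv.const _).sub (hint H.bwd.left.continuousOn)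
  have hbd : HasACDeriv b (fun t => -(h t * q t)) 0 P.T := by
    simpa using (HasACDeriv.const _).sub (hint H.fwd.left.continuousOn)
  -- The averaged primitives obey the same relations as those of one player, with `κ μ` multiplied
  -- by the surviving mass.
  obtain ⟨hX, hY⟩ := hP.variation_of_constants H had hbd
  set X : ℝ → ℝ := fun t => P.G t * ((h P.T)⁻¹ * (u t * b t - h t * a t)) with hXdef
  set Y : ℝ → ℝ := fun t => (h P.T)⁻¹ * (p t * a t + w t * b t) with hYdef
  replace hX : HasACDeriv X (fun t => -((Y t - P.δ * P.κ t * X t) / P.η t)) 0 P.T := hX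
  replace hY : HasACDeriv Y (fun t => -(P.lam t * X t + q t)) 0 P.T := hY
  have hF : ∀ t ∈ uIcc 0 P.T, (Y t - P.δ * P.κ t * X t) / P.η t = P.F ν₀ μ t := by
    intro t ht
    rw [hP.mem_uIcc_iff] at ht
    have ia : Integrable (fun x => P.potential u μ (min P.T (P.τ μ x))
        - P.potential u μ (min t (P.τ μ x))) ν₀ := (hI P.T hP.T_mem).1.sub (hI t ht).1
    have ib : Integrable (fun x => x - P.f μ (min t (P.τ μ x))) ν₀ := hν₀.sub (hf t ht).1
    have ea : ∫ x, (P.potential u μ (min P.T (P.τ μ x))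
        - P.potential u μ (min t (P.τ μ x))) ∂ν₀ = a t := by
      rw [integral_sub (hI P.T hP.T_mem).1 (hI t ht).1, (hI P.T hP.T_mem).2, (hI t ht).2]
    have eb : ∫ x, (x - P.f μ (min t (P.τ μ x))) ∂ν₀ = b t := by
      rw [integral_sub hν₀ (hf t ht).1, (hf t ht).2, hb, mean]
    have hXt : Integrable (fun x => P.stateX h u μ x (min t (P.τ μ x))) ν₀ ∧
        ∫ x, P.stateX h u μ x (min t (P.τ μ x)) ∂ν₀ = X t := by
      simp only [fun x => (hP.state_min_τ (p := p) (w := w) (h := h) (u := u) hμ ht.2 x).1]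
      refine ⟨(((ib.const_mul _).sub (ia.const_mul _)).const_mul _).const_mul _, ?_⟩
      rw [integral_const_mul, integral_const_mul, integral_sub (ib.const_mul _) (ia.const_mul _),
        integral_const_mul, integral_const_mul, ea, eb]
    have hYt : Integrable (fun x => P.stateY h p u w μ x (min t (P.τ μ x))) ν₀ ∧
        ∫ x, P.stateY h p u w μ x (min t (P.τ μ x)) ∂ν₀ = Y t := by
      simp only [fun x => (hP.state_min_τ (p := p) (w := w) (h := h) (u := u) hμ ht.2 x).2]
      refine ⟨((ia.const_mul _).add (ib.const_mul _)).const_mul _, ?_⟩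
      rw [integral_const_mul, integral_add (ia.const_mul _) (ib.const_mul _),
        integral_const_mul, integral_const_mul, ea, eb]
    simp only [F, hP.ξ_eq H hμ ht]
    rw [integral_div, integral_sub hYt.1 (hXt.1.const_mul _), integral_const_mul, hXt.2, hYt.2]
  have hXT : X P.T = 0 := by simp [hXdef, ha, H.u_T]
  have hX0 : X 0 = mean ν₀ := by
    simp only [hXdef, hb, G_zero, H.u_zero, H.h_zero, intervalIntegral.integral_same]
    field_simp
    ring
  refine ⟨X, hX.congr_deriv_on fun t ht => by rw [← hF t ht], hXT, hX0, ?_, ?_⟩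
  · refine (((hY.sub ((hP.hasACDeriv_κ.const_mul P.δ).mul hX)).div hP.hasACDeriv_η
      fun t ht => (hP.η_pos t (hP.mem_uIcc_iff.1 ht)).ne').congr hF).congr_deriv_on
      fun t ht => ?_
    have h1 := (hP.η_pos t (hP.mem_uIcc_iff.1 ht)).ne'
    simp only [← hF t ht, hq]
    field_simp
    ring
  -- At `T` the mean state and `a` vanish and `w = 1`, leaving `b(T) / (h(T) η_T)`.
  · rw [← hF P.T right_mem_uIcc, hXT, hP.α_eq H]
    have h1 := (hf P.T hP.T_mem).2
    simp only [min_eq_right (hP.τ_mem (μ := μ)).2] at h1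
    rw [h1]
    simp only [hYdef, ha, hb, H.w_T, sub_self, mul_zero, zero_add, one_mul, sub_zero]
    ring

end Admissible
end Params
end Liquidation

/-! ### Surviving mass and terminal value for positive `μ` -/

namespace Liquidation

theorem q₀_antitone (ν₀ : Measure ℝ) [IsFiniteMeasure ν₀] : Antitone (q₀ ν₀) := fun _ _ hst =>
  measureReal_mono (Ici_subset_Ici.2 hst)

namespace Params

variable {P : Params} {μ : ℝ → ℝ} {ν₀ : Measure ℝ}

namespace Admissible

variable (hP : P.Admissible)
include hP

theorem f_nonneg_mono (hμ : IntervalIntegrable μ volume 0 P.T) (hpos : ∀ t ∈ Icc 0 P.T, 0 < μ t)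
    {r s : ℝ} (hr : r ∈ Icc 0 P.T) (hs : s ∈ Icc 0 P.T) (hrs : r ≤ s) : P.f μ r ≤ P.f μ s := by
  obtain ⟨h, p, u, w, H⟩ := hP.exists_isFundamental
  refine (hP.hasACDeriv_f H hμ).le_of_deriv_nonneg ?_ (hP.mem_uIcc_iff.2 hr)
    (hP.mem_uIcc_iff.2 hs) hrs
  refine ae_of_all _ fun t ht => ?_
  rw [hP.mem_uIcc_iff] at ht
  have hh : 0 ≤ h t := by
    rcases ht.1.eq_or_lt with h0 | h0
    · rw [← h0, H.h_zero]
    · exact (H.h_pos t ⟨h0, ht.2⟩).le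
  exact mul_nonneg hh (mul_nonneg (hP.κ_nonneg t ht) (hpos t ht).le)

theorem f_nonneg (hμ : IntervalIntegrable μ volume 0 P.T) (hpos : ∀ t ∈ Icc 0 P.T, 0 < μ t)
    {s : ℝ} (hs : s ∈ Icc 0 P.T) : 0 ≤ P.f μ s := by
  simpa [f_zero] using hP.f_nonneg_mono hμ hpos hP.zero_mem hs hs.1

/-- By continuity `κ > 0` on a left neighbourhood of `s`, so `f_μ` increases strictly just before
`s`. -/
theorem f_lt_f (hμ : IntervalIntegrable μ volume 0 P.T) (hpos : ∀ t ∈ Icc 0 P.T, 0 < μ t)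
    {r s : ℝ} (hr : 0 ≤ r) (hrs : r < s) (hs : s ≤ P.T) (hκ : P.κ s ≠ 0) :
    P.f μ r < P.f μ s := by
  obtain ⟨h, p, u, w, H⟩ := hP.exists_isFundamental
  have hsI : s ∈ Icc 0 P.T := ⟨hr.trans hrs.le, hs⟩
  have hev : ∀ᶠ t in 𝓝[<] s, 0 < P.κ t := by
    have h1 : ∀ᶠ t in 𝓝[Icc 0 P.T] s, 0 < P.κ t :=
      (hP.continuousOn_κ s hsI).eventually_const_lt ((hP.κ_nonneg s hsI).lt_of_ne' hκ)
    refine nhdsWithin_le_iff.2 ?_ h1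
    filter_upwards [Ico_mem_nhdsLT (hr.trans_lt hrs)] with t ht
    exact ⟨ht.1, ht.2.le.trans hs⟩
  obtain ⟨l, hl, hls⟩ := (mem_nhdsLT_iff_exists_Ioo_subset' hrs).1 hev
  set c := max l r with hc
  have hcs : c < s := max_lt hl hrs
  have hrc : r ≤ c := le_max_right _ _
  have hcI : c ∈ Icc 0 P.T := ⟨hr.trans hrc, hcs.le.trans hs⟩
  refine (hP.f_nonneg_mono hμ hpos ⟨hr, hrs.le.trans hs⟩ hcI hrc).trans_lt ?_
  have hd := (hP.hasACDeriv_f H hμ).mono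
    (uIcc_subset_uIcc (hP.mem_uIcc_iff.2 hcI) (hP.mem_uIcc_iff.2 hsI))
  rw [← sub_pos, ← hd.integral_eq_sub]
  refine intervalIntegral.intervalIntegral_pos_of_pos_on hd.intervalIntegrable (fun t ht => ?_) hcs
  have ht0 : 0 < t := (hcI.1).trans_lt ht.1
  have htT : t ≤ P.T := ht.2.le.trans hs
  exact mul_pos (H.h_pos t ⟨ht0, htT⟩)
    (mul_pos (hls ⟨(le_max_left _ _).trans_lt ht.1, ht.2⟩) (hpos t ⟨ht0.le, htT⟩))

theorem exists_f_eq (hμ : IntervalIntegrable μ volume 0 P.T) {s x : ℝ} (hs : s ∈ Icc 0 P.T)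
    (hx0 : 0 ≤ x) (hxs : x < P.f μ s) : ∃ r ∈ Ico 0 s, P.f μ r = x := by
  obtain ⟨r, hr, hrx⟩ := intermediate_value_Icc hs.1
    ((hP.continuousOn_f hμ).mono (Icc_subset_Icc_right hs.2)) ⟨f_zero.trans_le hx0, hxs.le⟩
  refine ⟨r, ⟨hr.1, hr.2.lt_of_ne ?_⟩, hrx⟩
  rintro rfl
  exact hxs.ne hrx.symm

variable [IsProbabilityMeasure ν₀]

/-- A player with `x < 0` never meets `f_μ ≥ 0`, and one with `x > 0` has left before `s` exactly
when `x < f_μ(s)`. The factor `κ` is essential: if `f_μ` is flat just before `s`, an atom of `ν₀` at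
`f_μ(s)` has left already but is counted by `q₀`. -/
theorem κ_mul_survival (hν0 : ν₀ {0} = 0) (hμ : IntervalIntegrable μ volume 0 P.T)
    (hpos : ∀ t ∈ Icc 0 P.T, 0 < μ t) {s : ℝ} (hs : s ∈ Ioc 0 P.T) :
    P.κ s * P.survival ν₀ μ s = P.κ s * (q₀ ν₀ (P.f μ s) + p₀ ν₀ 0) := by
  by_cases hκ : P.κ s = 0
  · simp [hκ]
  congr 1
  have hsI := Ioc_subset_Icc_self hs
  have hlt : ∀ r ∈ Ico 0 s, P.f μ r < P.f μ s := fun r hr =>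
    hP.f_lt_f hμ hpos hr.1 hr.2 hs.2 hκ
  have hfs : 0 < P.f μ s := by
    have := hlt 0 ⟨le_rfl, hs.1⟩
    rwa [f_zero] at this
  have hdisj : Disjoint (Ici (P.f μ s)) (Iic 0) :=
    Set.disjoint_left.2 fun x hx hx' => (hfs.trans_le hx).not_ge hx'
  rw [q₀, p₀, ← measureReal_union hdisj measurableSet_Iic, survival]
  refine measureReal_congr ?_
  have hne : ∀ᵐ x ∂ν₀, x ≠ 0 := by
    rw [ae_iff]
    simpa using hν0
  filter_upwards [hne] with x hx
  refine propext ?_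
  change s ≤ P.τ μ x ↔ P.f μ s ≤ x ∨ x ≤ 0
  rw [← not_lt, hP.τ_lt_iff hμ hs.2, ← not_iff_not, not_not, not_or, not_le, not_le]
  constructor
  · rintro ⟨r, hr, rfl⟩
    exact ⟨hlt r hr, (hP.f_nonneg hμ hpos ⟨hr.1, hr.2.le.trans hs.2⟩).lt_of_ne' hx⟩
  · rintro ⟨h1, h2⟩
    exact hP.exists_f_eq hμ hsI h2.le h1

/-- With `c = f_μ(T)`, the integrand is `c` for `x < 0` and `min x c` for `x > 0`; the second part
is integrated by the layer-cake formula. -/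
theorem integral_f_τ (hν0 : ν₀ {0} = 0) (hμ : IntervalIntegrable μ volume 0 P.T)
    (hpos : ∀ t ∈ Icc 0 P.T, 0 < μ t) :
    ∫ x, P.f μ (P.τ μ x) ∂ν₀ =
      (1 - q₀ ν₀ 0) * P.f μ P.T + ∫ x in (0 : ℝ)..(P.f μ P.T), q₀ ν₀ x := by
  set c := P.f μ P.T with hc
  have hc0 : 0 ≤ c := hP.f_nonneg hμ hpos hP.T_mem
  have hne : ∀ᵐ x ∂ν₀, x ≠ 0 := by
    rw [ae_iff]
    simpa using hν0
  have h1 := integrable_and_integral_indicator_Iic (ν := ν₀) (σ := fun x => x) (g := fun _ => 1)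
    measurable_id hc0 intervalIntegrable_const
  have h2 : Integrable ((Iio (0 : ℝ)).indicator fun _ => c) ν₀ :=
    (integrable_const c).indicator measurableSet_Iio
  have h3 : (fun x => P.f μ (P.τ μ x)) =ᵐ[ν₀] fun x => (Iio (0 : ℝ)).indicator (fun _ => c) x +
      ∫ s in (0 : ℝ)..c, (Iic x).indicator (fun _ => (1 : ℝ)) s := by
    filter_upwards [hne] with x hx
    have hτ := hP.τ_mem (μ := μ) (x := x)
    rcases lt_or_gt_of_ne hx with hneg | hpos'
    · have hτT : P.τ μ x = P.T := by
        refine hτ.2.eq_of_not_lt fun hlt => ?_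
        have := hP.f_nonneg hμ hpos hτ
        rw [hP.f_τ hμ hlt] at this
        exact this.not_gt hneg
      rw [hτT, indicator_of_mem (mem_Iio.2 hneg), intervalIntegral.integral_of_le hc0,
        setIntegral_indicator measurableSet_Iic, Ioc_inter_Iic,
        Ioc_eq_empty (by simp [hneg.le])]
      simp [hc]
    · rw [indicator_of_notMem (by simp [hpos'.le]), integral_indicator_Iic hc0 hpos'.le]
      simp only [intervalIntegral.integral_const, sub_zero, smul_eq_mul, mul_one, zero_add]
      rcases hτ.2.lt_or_eq with hlt | heq
      · have h4 := hP.f_nonneg_mono hμ hpos hτ hP.T_mem hτ.2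
        rw [hP.f_τ hμ hlt] at h4 ⊢
        exact (min_eq_right h4).symm
      · rw [heq, min_eq_left]
        by_contra! hlt
        obtain ⟨r, hr, hrx⟩ := hP.exists_f_eq hμ hP.T_mem hpos'.le hlt
        exact ((hP.τ_lt_iff hμ le_rfl).2 ⟨r, hr, hrx⟩).ne heq
  rw [integral_congr_ae h3, integral_add h2 h1.1, h1.2,
    integral_indicator_const _ measurableSet_Iio, smul_eq_mul]
  congr 1
  · rw [q₀, ← probReal_compl_eq_one_sub measurableSet_Ici, compl_Ici]
  · exact intervalIntegral.integral_congr fun s _ => mul_one _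

end Admissible
end Params
end Liquidation

/-! ### Fixed points: sign, equivalence and reflection -/

namespace Liquidation

namespace Params

variable {P : Params} {μ : ℝ → ℝ} {ν₀ : Measure ℝ}

namespace Admissible

variable (hP : P.Admissible)
include hP

theorem memLp_top_lam_coeff :
    MemLp (fun t => (P.lam t + P.δ * P.dκ t) / P.η t) ⊤ (volume.restrict (Icc 0 P.T)) := by
  simp only [div_eq_mul_inv]
  exact (hP.lam_memLp.add (continuousOn_const.mul hP.continuousOn_dκ).memLp_top_Icc).mul_top
    hP.continuousOn_inv_η.memLp_top_Icc

theorem lam_coeff_nonneg : ∀ᵐ t, t ∈ Icc 0 P.T → 0 ≤ (P.lam t + P.δ * P.dκ t) / P.η t := by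
  filter_upwards [(ae_restrict_iff' measurableSet_Icc).1 hP.lam_add_nonneg] with t ht hts
  exact div_nonneg (ht hts) (hP.η_pos t hts).le

theorem memLp_top_κ_coeff {n : ℝ → ℝ} (hn : MemLp n ⊤ (volume.restrict (Icc 0 P.T))) :
    MemLp (fun t => P.κ t / P.η t * n t) ⊤ (volume.restrict (Icc 0 P.T)) :=
  (hP.continuousOn_κ.div hP.continuousOn_η fun t ht => (hP.η_pos t ht).ne').memLp_top_Icc.mul_top hn

theorem memLp_top_η_coeff :
    MemLp (fun t => (P.dη t - P.δ * P.κ t) / P.η t) ⊤ (volume.restrict (Icc 0 P.T)) :=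
  ((hP.continuousOn_dη.sub (continuousOn_const.mul hP.continuousOn_κ)).div hP.continuousOn_η
    fun t ht => (hP.η_pos t ht).ne').memLp_top_Icc

theorem intervalIntegrable_memLp_top_mul {a : ℝ → ℝ}
    (ha : MemLp a ⊤ (volume.restrict (Icc 0 P.T))) (hμ : IntervalIntegrable μ volume 0 P.T) :
    IntervalIntegrable (fun t => a t * μ t) volume 0 P.T := by
  rw [intervalIntegrable_iff_integrableOn_Icc_of_le hP.T_pos.le] at hμ ⊢
  exact (memLp_one_iff_integrable.1 ((memLp_one_iff_integrable.2 hμ).mul ha :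
    MemLp (a * μ) 1 (volume.restrict (Icc 0 P.T))))

omit hP in
theorem hasACDeriv_integral_right (hμ : IntervalIntegrable μ volume 0 P.T) :
    HasACDeriv (fun t => ∫ u in t..P.T, μ u) (fun t => -μ t) 0 P.T :=
  HasACDeriv.of_integral hμ.neg right_mem_uIcc (k := 0) fun t _ => by
    rw [zero_add, intervalIntegral.integral_neg, intervalIntegral.integral_symm t P.T, neg_neg]

theorem memLp_top_tail [IsProbabilityMeasure ν₀] (hμ : IntervalIntegrable μ volume 0 P.T) :
    MemLp (fun t => q₀ ν₀ (P.f μ t) + p₀ ν₀ 0) ⊤ (volume.restrict (Icc 0 P.T)) := by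
  have h1 : AEStronglyMeasurable (fun t => q₀ ν₀ (P.f μ t)) (volume.restrict (Icc 0 P.T)) :=
    ((q₀_antitone ν₀).measurable.comp_aemeasurable
      ((hP.continuousOn_f hμ).aemeasurable measurableSet_Icc)).aestronglyMeasurable
  refine MemLp.add (memLp_top_of_bound h1 1 (ae_of_all _ fun t => ?_)) (memLp_top_const _)
  rw [Real.norm_eq_abs, q₀, abs_of_nonneg measureReal_nonneg]
  exact measureReal_le_one

/-- The differential form puts the equation within reach of `sign_eq_of_damped` and lets it be
compared with the equation for `F(μ)`. -/
theorem solvesSimplified_iff [IsProbabilityMeasure ν₀] (hμ : IntervalIntegrable μ volume 0 P.T) :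
    P.SolvesSimplified ν₀ μ ↔ HasACDeriv μ
      (fun s => -(P.κ s / P.η s * (q₀ ν₀ (P.f μ s) + p₀ ν₀ 0) * μ s
        + (P.lam s + P.δ * P.dκ s) / P.η s * (∫ u in s..P.T, μ u)
        + (P.dη s - P.δ * P.κ s) / P.η s * μ s)) 0 P.T := by
  have i1 := hP.intervalIntegrable_memLp_top_mul
    (hP.memLp_top_κ_coeff (hP.memLp_top_tail (ν₀ := ν₀) hμ)) hμ
  have i2 := (hP.memLp_top_lam_coeff.intervalIntegrable_of_top hP.T_pos.le).mul_continuousOn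
    (hasACDeriv_integral_right hμ).continuousOn
  have i3 := hP.intervalIntegrable_memLp_top_mul hP.memLp_top_η_coeff hμ
  have hsum : ∀ t ∈ Icc 0 P.T, (∫ s in t..P.T, P.κ s / P.η s * (q₀ ν₀ (P.f μ s) + p₀ ν₀ 0) * μ s)
      + (∫ s in t..P.T, (P.lam s + P.δ * P.dκ s) / P.η s * ∫ u in s..P.T, μ u)
      + (∫ s in t..P.T, (P.dη s - P.δ * P.κ s) / P.η s * μ s)
      = ∫ s in t..P.T, (P.κ s / P.η s * (q₀ ν₀ (P.f μ s) + p₀ ν₀ 0) * μ s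
        + (P.lam s + P.δ * P.dκ s) / P.η s * (∫ u in s..P.T, μ u)
        + (P.dη s - P.δ * P.κ s) / P.η s * μ s) := by
    intro t ht
    have hsub : uIcc t P.T ⊆ uIcc 0 P.T :=
      uIcc_subset_uIcc (hP.mem_uIcc_iff.2 ht) right_mem_uIcc
    rw [intervalIntegral.integral_add ((i1.mono_set hsub).add (i2.mono_set hsub))
      (i3.mono_set hsub), intervalIntegral.integral_add (i1.mono_set hsub) (i2.mono_set hsub)]
  constructor
  · intro hS
    refine HasACDeriv.of_integral ((i1.add i2).add i3).neg right_mem_uIcc (k := μ P.T)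
      fun t ht => ?_
    rw [hP.mem_uIcc_iff] at ht
    rw [hS t ht, add_assoc, add_assoc, ← add_assoc (∫ s in t..P.T, _), hsum t ht,
      intervalIntegral.integral_neg, intervalIntegral.integral_symm t P.T, neg_neg]
  · intro hd t ht
    have h1 := hd.neg.integral_eq_sub_of_mem (hP.mem_uIcc_iff.2 ht) right_mem_uIcc
    simp only [neg_neg] at h1
    rw [add_assoc, add_assoc, ← add_assoc (∫ s in t..P.T, _), hsum t ht, h1]
    ring

variable [IsProbabilityMeasure ν₀]

/-- Substituting `μ = F(μ)` in the source makes it part of the damping, so the sign principle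
applies to the mean state and `F(μ)`. -/
theorem sign_eq_of_isFixedPoint (hν₀ : Integrable (fun x : ℝ => x) ν₀)
    (hμ : IntervalIntegrable μ volume 0 P.T) (hfix : P.IsFixedPoint ν₀ μ) :
    ∀ t ∈ Icc 0 P.T, SignType.sign (μ t) = SignType.sign (mean ν₀) := by
  obtain ⟨h, p, u, w, H⟩ := hP.exists_isFundamental
  obtain ⟨X, hX, hXT, hX0, hF, -⟩ := hP.exists_aggregate H hν₀ hμ
  have key := sign_eq_of_damped hP.T_pos hP.memLp_top_lam_coeff hP.lam_coeff_nonneg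
    (b := fun t => P.κ t / P.η t * P.survival ν₀ μ t + (P.dη t - P.δ * P.κ t) / P.η t)
    ((hP.memLp_top_κ_coeff memLp_top_survival).add hP.memLp_top_η_coeff) hX
    (hF.congr_deriv_on fun t ht => by
      linear_combination (-(P.κ t / P.η t * P.survival ν₀ μ t)) *
        hfix t (hP.mem_uIcc_iff.1 ht)) hXT
  intro t ht
  rw [hfix t ht, key.1 t ht, ← hX0, key.2]

theorem κ_survival_ae (hν0 : ν₀ {0} = 0) (hμ : IntervalIntegrable μ volume 0 P.T)
    (hpos : ∀ t ∈ Icc 0 P.T, 0 < μ t) : ∀ᵐ s, s ∈ uIcc 0 P.T →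
      P.κ s / P.η s * P.survival ν₀ μ s * μ s =
        P.κ s / P.η s * (q₀ ν₀ (P.f μ s) + p₀ ν₀ 0) * μ s := by
  filter_upwards [ae_mem_uIcc_imp_mem_uIoo 0 P.T] with s hs hsT
  have hs' := hs hsT
  rw [uIoo_of_le hP.T_pos.le] at hs'
  have := hP.κ_mul_survival hν0 hμ hpos (Ioo_subset_Ioc_self hs')
  linear_combination (μ s / P.η s) * this

theorem F_T_eq (hν₀ : Integrable (fun x : ℝ => x) ν₀) (hν0 : ν₀ {0} = 0)
    (hμ : IntervalIntegrable μ volume 0 P.T) (hpos : ∀ t ∈ Icc 0 P.T, 0 < μ t) :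
    P.F ν₀ μ P.T = P.α / P.η P.T *
      (mean ν₀ - (1 - q₀ ν₀ 0) * P.f μ P.T - ∫ x in (0 : ℝ)..(P.f μ P.T), q₀ ν₀ x) := by
  obtain ⟨h, p, u, w, H⟩ := hP.exists_isFundamental
  obtain ⟨-, -, -, -, -, hFT⟩ := hP.exists_aggregate H hν₀ hμ
  rw [hFT, hP.integral_f_τ hν0 hμ hpos, sub_sub]

theorem simplified_of_isFixedPoint (hν₀ : Integrable (fun x : ℝ => x) ν₀) (hE : 0 < mean ν₀)
    (hν0 : ν₀ {0} = 0) (hμ : IntervalIntegrable μ volume 0 P.T) (hfix : P.IsFixedPoint ν₀ μ) :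
    P.SolvesSimplified ν₀ μ ∧ P.TerminalCondition ν₀ μ := by
  have hpos : ∀ t ∈ Icc 0 P.T, 0 < μ t := fun t ht => by
    have := hP.sign_eq_of_isFixedPoint hν₀ hμ hfix t ht
    rwa [sign_pos hE, sign_eq_one_iff] at this
  obtain ⟨h, p, u, w, H⟩ := hP.exists_isFundamental
  obtain ⟨X, hX, hXT, -, hF, -⟩ := hP.exists_aggregate H hν₀ hμ
  constructor
  · rw [hP.solvesSimplified_iff hμ]
    refine (hF.congr fun t ht => (hfix t (hP.mem_uIcc_iff.1 ht)).symm).congr_deriv ?_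
    filter_upwards [hP.κ_survival_ae hν0 hμ hpos] with t h1 ht
    have htT := hP.mem_uIcc_iff.1 ht
    -- At a fixed point the mean state is the remaining aggregate trade, since `X_T = 0`.
    have hXt : X t = ∫ v in t..P.T, μ v := by
      have h2 := hX.neg.integral_eq_sub_of_mem ht right_mem_uIcc
      rw [hXT] at h2
      rw [intervalIntegral.integral_congr (g := fun v => - -P.F ν₀ μ v), h2]
      · ring
      · intro v hv
        simp only [neg_neg]
        exact hfix v (hP.mem_uIcc_iff.1 (uIcc_subset_uIcc ht right_mem_uIcc hv))
    rw [← h1 ht, ← hfix t htT, hXt]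
    ring
  · rw [TerminalCondition, hfix P.T hP.T_mem, hP.F_T_eq hν₀ hν0 hμ hpos]

/-- The sign principle with `m = ∫_t^T μ`, `z = μ` leaves only the sign of `μ_T` open. If `μ_T ≤ 0`,
then `f_μ(T) ≤ 0`, both subtracted terms of the terminal condition are nonpositive, and `E[ν₀] > 0`
gives `μ_T > 0`. -/
theorem pos_of_simplified (hE : 0 < mean ν₀) (hμ : IntervalIntegrable μ volume 0 P.T)
    (hS : P.SolvesSimplified ν₀ μ) (hT : P.TerminalCondition ν₀ μ) :
    ∀ t ∈ Icc 0 P.T, 0 < μ t := by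
  obtain ⟨h, p, u, w, H⟩ := hP.exists_isFundamental
  have key := (sign_eq_of_damped hP.T_pos hP.memLp_top_lam_coeff hP.lam_coeff_nonneg
    (b := fun t => P.κ t / P.η t * (q₀ ν₀ (P.f μ t) + p₀ ν₀ 0)
      + (P.dη t - P.δ * P.κ t) / P.η t)
    ((hP.memLp_top_κ_coeff (hP.memLp_top_tail hμ)).add hP.memLp_top_η_coeff)
    (hasACDeriv_integral_right hμ)
    (((hP.solvesSimplified_iff hμ).1 hS).congr_deriv_on fun t _ => by ring)
    intervalIntegral.integral_same).1
  suffices hpos : 0 < μ P.T by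
    intro t ht
    have := key t ht
    rwa [sign_pos hpos, sign_eq_one_iff] at this
  by_contra! hle
  have hnonpos : ∀ t ∈ Icc 0 P.T, μ t ≤ 0 := fun t ht => by
    rw [← sign_nonpos_iff, key t ht, sign_nonpos_iff]
    exact hle
  have hf : P.f μ P.T ≤ 0 := by
    have := (hP.hasACDeriv_f H hμ).neg.le_of_deriv_nonneg (ae_of_all _ fun t ht => ?_)
      left_mem_uIcc right_mem_uIcc hP.T_pos.le
    · rw [f_zero] at this
      linarith
    · rw [hP.mem_uIcc_iff] at ht
      have hh : 0 ≤ h t := by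
        rcases ht.1.eq_or_lt with h0 | h0
        · rw [← h0, H.h_zero]
        · exact (H.h_pos t ⟨h0, ht.2⟩).le
      exact neg_nonneg.2 (mul_nonpos_of_nonneg_of_nonpos hh
        (mul_nonpos_of_nonneg_of_nonpos (hP.κ_nonneg t ht) (hnonpos t ht)))
  have hα : 0 < P.α / P.η P.T := by
    rw [hP.α_eq H]
    exact div_pos (inv_pos.2 (H.h_pos P.T ⟨hP.T_pos, le_rfl⟩)) (hP.η_pos P.T hP.T_mem)
  have hq : 0 ≤ ∫ x in (P.f μ P.T)..0, q₀ ν₀ x :=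
    intervalIntegral.integral_nonneg hf fun x _ => measureReal_nonneg
  have hq1 : q₀ ν₀ 0 ≤ 1 := measureReal_le_one
  rw [TerminalCondition, intervalIntegral.integral_symm] at hT
  have h1 := mul_nonneg (sub_nonneg.2 hq1) (neg_nonneg.2 hf)
  have h2 : 0 < μ P.T := by
    rw [hT]
    exact mul_pos hα (by linarith)
  exact h2.not_ge hle

theorem isFixedPoint_of_simplified (hν₀ : Integrable (fun x : ℝ => x) ν₀) (hE : 0 < mean ν₀)
    (hν0 : ν₀ {0} = 0) (hμ : IntervalIntegrable μ volume 0 P.T)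
    (hS : P.SolvesSimplified ν₀ μ) (hT : P.TerminalCondition ν₀ μ) : P.IsFixedPoint ν₀ μ := by
  have hpos := hP.pos_of_simplified hE hμ hS hT
  obtain ⟨h, p, u, w, H⟩ := hP.exists_isFundamental
  obtain ⟨X, hX, hXT, -, hF, -⟩ := hP.exists_aggregate H hν₀ hμ
  have hμT : μ P.T - P.F ν₀ μ P.T = 0 := by
    rw [hP.F_T_eq hν₀ hν0 hμ hpos, hT, sub_self]
  -- Both equations contain the same source in `κ μ`, because `μ > 0`; it cancels, and the
  -- difference solves a homogeneous damped system with terminal value `0`.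
  have hd : HasACDeriv (fun t => μ t - P.F ν₀ μ t)
      (fun t => -((P.lam t + P.δ * P.dκ t) / P.η t * ((∫ u in t..P.T, μ u) - X t)
        + (P.dη t - P.δ * P.κ t) / P.η t * (μ t - P.F ν₀ μ t))) 0 P.T := by
    refine (((hP.solvesSimplified_iff hμ).1 hS).sub hF).congr_deriv ?_
    filter_upwards [hP.κ_survival_ae hν0 hμ hpos] with t h1 ht
    rw [← h1 ht]
    ring
  have hm := ((hasACDeriv_integral_right hμ).sub hX).congr_deriv_on
    (G' := fun t => -(μ t - P.F ν₀ μ t)) fun t _ => by ring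
  have key := (sign_eq_of_damped hP.T_pos hP.memLp_top_lam_coeff hP.lam_coeff_nonneg
    hP.memLp_top_η_coeff hm hd (by simp [hXT])).1
  intro t ht
  have := key t ht
  rw [hμT, sign_zero, sign_eq_zero_iff] at this
  linarith

omit hP [IsProbabilityMeasure ν₀] in
theorem f_neg : P.f (fun t => -μ t) = fun t => -P.f μ t := by
  ext t
  simp [f]

omit hP [IsProbabilityMeasure ν₀] in
theorem potential_neg (u : ℝ → ℝ) :
    P.potential u (fun t => -μ t) = fun t => -P.potential u μ t := by
  ext t
  simp [potential]

omit hP [IsProbabilityMeasure ν₀] in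
theorem τ_neg (x : ℝ) : P.τ (fun t => -μ t) (-x) = P.τ μ x := by
  unfold τ
  have e : ∀ t, P.f (fun t => -μ t) t = -x ↔ P.f μ t = x := fun t => by rw [f_neg, neg_inj]
  by_cases hx : ∃ t ∈ Icc 0 P.T, P.f μ t = x
  · rw [if_pos hx, if_pos (by simpa only [e] using hx)]
    simp only [e]
  · rw [if_neg hx, if_neg (by simpa only [e] using hx)]

omit [IsProbabilityMeasure ν₀] in
-- The exit time is unchanged under the reflection and the explicit formulas are odd in `(x, μ)`.
theorem ξ_neg (hμ : IntervalIntegrable μ volume 0 P.T) {t : ℝ} (ht : t ∈ Icc 0 P.T) (x : ℝ) :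
    P.ξ (fun t => -μ t) (-x) t = -P.ξ μ x t := by
  obtain ⟨h, p, u, w, H⟩ := hP.exists_isFundamental
  have hμ' : IntervalIntegrable (fun t => -μ t) volume 0 P.T := hμ.neg
  rw [hP.ξ_eq H hμ ht, hP.ξ_eq H hμ' ht, τ_neg]
  simp only [stateX, stateY, f_neg, potential_neg, τ_neg]
  ring

omit [IsProbabilityMeasure ν₀] in
theorem F_neg (hμ : IntervalIntegrable μ volume 0 P.T) {t : ℝ} (ht : t ∈ Icc 0 P.T) :
    P.F (ν₀.map fun x => -x) (fun t => -μ t) t = -P.F ν₀ μ t := by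
  -- Reflection is a measurable embedding, so the change of variables requires no measurability of
  -- `ξ` in `x`.
  refine ((Homeomorph.neg ℝ).measurableEmbedding.integral_map
    (fun x => P.ξ (fun t => -μ t) x t)).trans ?_
  simp only [Homeomorph.coe_neg, hP.ξ_neg hμ ht, integral_neg, F]

end Admissible
end Params

theorem mean_map_neg (ν₀ : Measure ℝ) : mean (ν₀.map fun x => -x) = -mean ν₀ := by
  exact ((Homeomorph.neg ℝ).measurableEmbedding.integral_map (fun x : ℝ => x)).trans
    (integral_neg _)

end Liquidation

end

theorem mainTheorem7 (P : Liquidation.Params) (hP : P.Admissible)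
    (ν₀ : Measure ℝ) [IsProbabilityMeasure ν₀] (hν₀ : Integrable (fun x : ℝ => x) ν₀) :
    (∀ μ : ℝ → ℝ, IntervalIntegrable μ volume 0 P.T → P.IsFixedPoint ν₀ μ →
      ∀ t ∈ Icc 0 P.T, SignType.sign (μ t) = SignType.sign (Liquidation.mean ν₀)) ∧
    (0 < Liquidation.mean ν₀ → ν₀ {0} = 0 →
      ∀ μ : ℝ → ℝ, IntervalIntegrable μ volume 0 P.T →
        (P.IsFixedPoint ν₀ μ ↔ P.SolvesSimplified ν₀ μ ∧ P.TerminalCondition ν₀ μ)) ∧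
    (Liquidation.mean ν₀ < 0 →
      0 < Liquidation.mean (ν₀.map (fun x => -x)) ∧
      ∀ μ : ℝ → ℝ, IntervalIntegrable μ volume 0 P.T →
        (P.IsFixedPoint ν₀ μ ↔
          P.IsFixedPoint (ν₀.map (fun x => -x)) (fun t => -μ t))) := by
  refine ⟨fun μ hμ hfix => hP.sign_eq_of_isFixedPoint hν₀ hμ hfix, fun hE hν0 μ hμ =>
    ⟨hP.simplified_of_isFixedPoint hν₀ hE hν0 hμ, fun h =>
      hP.isFixedPoint_of_simplified hν₀ hE hν0 hμ h.1 h.2⟩, fun hE => ⟨?_, fun μ hμ => ?_⟩⟩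
  · rw [Liquidation.mean_map_neg]
    exact neg_pos.2 hE
  · refine forall₂_congr fun t ht => ?_
    rw [hP.F_neg hμ ht, neg_inj]
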